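/- All Hilbert spaces are finite-dimensional, complex, nonzero, with a fixed computational basis; $\mathcal L(\mathcal H)$ denotes the operators on $\mathcal H$. The Choi operator of a linear map $\mathcal E:\mathcal L(I)\to\mathcal L(O)$ is $\sum_{i,i'}|i\rangle\langle i'|\otimes\mathcal E(|i\rangle\langle i'|)$; $|U\rangle\rangle=\sum_i|i\rangle\otimes U|i\rangle$; and the link product of $E\in\mathcal L(X\otimes Y)$ and $F\in\mathcal L(Y\otimes Z)$ is $E*F=\mathrm{Tr}_Y[(E\otimes 1_Z)(1_X\otimes F^{T_Y})]$. Definitions. A bipartite process matrix with global past $P$, global future $F$ and parties $A$, $B$ (input spaces $A_I,B_I$, output spaces $A_O,B_O$) is an operator $W\in\mathcal L(P\otimes A_O\otimes B_O\otimes A_I\otimes B_I\otimes F)$ such that, for all auxiliary spaces $A_I',A_O',B_I',B_O'$ and all Choi operators $E_A,E_B$ of quantum channels $\mathcal L(A_I\otimes A_I')\to\mathcal L(A_O\otimes A_O')$ and $\mathcal L(B_I\otimes B_I')\to\mathcal L(B_O\otimes B_O')$, $W*(E_A\otimes E_B)$ is the Choi operator of a channel $\mathcal L(P\otimes A_I'\otimes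 B_I')\to\mathcal L(F\otimes A_O'\otimes B_O')$. It is pure if, moreover, for all auxiliary spaces and all unitaries $U_A:A_I\otimes A_I'\to A_O\otimes A_O'$ and $U_B:B_I\otimes B_I'\to B_O\otimes B_O'$, $W*(|U_A\rangle\rangle\langle\langle U_A|\otimes|U_B\rangle\rangle\langle\langle U_B|)=|U_G\rangle\rangle\langle\langle U_G|$ for some unitary $U_G$. $W$ is purifiable if there are spaces $P_s,F_s$, a unit vector $\psi\in P_s$ and a pure process matrix $W'$ with global past $P\otimes P_s$, global future $F\otimes F_s$ and the same parties such that $W=W'*(|\psi\rangle\langle\psi|\otimes 1_{F_s})$. A one-slot comb $[\mathcal L(X)\to\mathcal L(Y)]\to[\mathcal L(Q)\to\mathcal L(R)]$ is (the Choi operator of) a supermap which, applied to part of any channel $\mathcal L(X\otimes X')\to\mathcal L(Y\otimes Y')$, gives a channel $\mathcal L(Q\otimes X')\to\mathcal L(R\otimes Y')$. $W$ is ordered $A\prec B$ (a quantum comb of $A\prec B$) if, for all auxiliary $A_I',B_O'$ and all one-slot combs $S:[\mathcal L(A_O)\to\mathcal L(B_I)]\to[\mathcal L(A_I\otimes A_I')\to\mathcal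 L(B_O\otimes B_O')]$, $W*S$ is the Choi operator of a channel $\mathcal L(P\otimes A_I')\to\mathcal L(F\otimes B_O')$; the order $B\prec A$ is defined by exchanging the parties. Statement. Let $W$ be a purifiable bipartite process matrix with trivial global future ($F=\mathbb C$). (1) If the global past is trivial as well ($\dim P=1$), then $W$ is causally separable: there are $q\in[0,1]$, a process $W_1$ ordered $A\prec B$ and a process $W_2$ ordered $B\prec A$ such that $W=q\,W_1+(1-q)\,W_2$. (2) For an arbitrary global past $P$, $W$ is a mixture of the two causal orders controlled by a measurement of the past: there are operators $K_1,K_2$ on $P$ with $K_1^\dagger K_1+K_2^\dagger K_2=1$, a process $W_1$ ordered $A\prec B$ and a process $W_2$ ordered $B\prec A$, with global past $P$ and trivial global future, such that $W=|K_1\rangle\rangle\langle\langle K_1|*W_1+|K_2\rangle\rangle\langle\langle K_2|*W_2$, that is, $W$ applies the Kraus map $\rho\mapsto K_i\rho K_i^\dagger$ to the past and then $W_i$, summed over $i=1,2$. -/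

import Mathlib

/-! Finite-dimensional Hilbert spaces with a fixed computational basis are written as finite index
types `X` (the space is `ℂ^X`); operators on `ℂ^X` are matrices `Matrix X X ℂ`, and the index type
of a tensor product is the product of the index types. -/

open scoped Matrix Kronecker ComplexOrder

noncomputable section

namespace ProcessMatrix

/-! ### Channels, Choi operators and the link product -/

/-- Rename or reorder tensor factors: the operator `M` read through the relabelling `f`. -/
def relabel {X Y : Type} (f : X → Y) (M : Matrix Y Y ℂ) : Matrix X X ℂ := M.submatrix f f

/-- The map `E ⊗ id` on `L(I ⊗ ℂⁿ)`. -/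
def ampliation {I O : Type} (E : Matrix I I ℂ →ₗ[ℂ] Matrix O O ℂ) (n : ℕ)
    (X : Matrix (I × Fin n) (I × Fin n) ℂ) : Matrix (O × Fin n) (O × Fin n) ℂ :=
  Matrix.of fun a b => E (Matrix.of fun i i' => X (i, a.2) (i', b.2)) a.1 b.1

/-- Complete positivity. -/
def IsCompletelyPositive {I O : Type} (E : Matrix I I ℂ →ₗ[ℂ] Matrix O O ℂ) : Prop :=
  ∀ (n : ℕ) (X : Matrix (I × Fin n) (I × Fin n) ℂ), X.PosSemidef → (ampliation E n X).PosSemidef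

/-- Quantum channels: completely positive trace-preserving maps. -/
def IsChannel {I O : Type} [Fintype I] [Fintype O]
    (E : Matrix I I ℂ →ₗ[ℂ] Matrix O O ℂ) : Prop :=
  IsCompletelyPositive E ∧ ∀ X : Matrix I I ℂ, (E X).trace = X.trace

/-- The Choi operator `∑ |i⟩⟨i'| ⊗ E(|i⟩⟨i'|)` of a map. -/
def choi {I O : Type} [DecidableEq I] (E : Matrix I I ℂ →ₗ[ℂ] Matrix O O ℂ) :
    Matrix (I × O) (I × O) ℂ :=
  Matrix.of fun a b => E (Matrix.single a.1 b.1 1) a.2 b.2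

/-- `C` is the Choi operator of a quantum channel from `L(I)` to `L(O)`. -/
def IsChannelChoi {I O : Type} [Fintype I] [DecidableEq I] [Fintype O]
    (C : Matrix (I × O) (I × O) ℂ) : Prop :=
  ∃ E : Matrix I I ℂ →ₗ[ℂ] Matrix O O ℂ, IsChannel E ∧ choi E = C

/-- The Choi vector `|U⟩⟩ = ∑ |i⟩ ⊗ U|i⟩` of an operator `U : I → O`. -/
def choiVec {I O : Type} (U : Matrix O I ℂ) : I × O → ℂ := fun a => U a.2 a.1

/-- The rank-one operator `|U⟩⟩⟨⟨U|`. -/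
def dketbra {I O : Type} (U : Matrix O I ℂ) : Matrix (I × O) (I × O) ℂ :=
  Matrix.vecMulVec (choiVec U) (star (choiVec U))

/-- A unitary operator between two spaces (of necessarily equal dimension). -/
def IsUnitary {I O : Type} [Fintype I] [DecidableEq I] [Fintype O] [DecidableEq O]
    (U : Matrix O I ℂ) : Prop :=
  Uᴴ * U = 1 ∧ U * Uᴴ = 1

/-- The link product `Tr_Y[(E ⊗ 1_Z)(1_X ⊗ F^{T_Y})]`, in coordinates;
see `linkProduct_eq` below. -/
def linkProduct {X Y Z : Type} [Fintype Y]
    (E : Matrix (X × Y) (X × Y) ℂ) (F : Matrix (Y × Z) (Y × Z) ℂ) :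
    Matrix (X × Z) (X × Z) ℂ :=
  Matrix.of fun a b => ∑ y : Y, ∑ y' : Y, E (a.1, y) (b.1, y') * F (y, a.2) (y', b.2)

/-- Partial transposition of the first tensor factor. -/
def partialTransposeFst {Y Z : Type} (F : Matrix (Y × Z) (Y × Z) ℂ) :
    Matrix (Y × Z) (Y × Z) ℂ :=
  Matrix.of fun a b => F (b.1, a.2) (a.1, b.2)

/-- The coordinate formula for the link product agrees with
`Tr_Y[(E ⊗ 1_Z)(1_X ⊗ F^{T_Y})]`. -/
theorem linkProduct_eq {X Y Z : Type} [Fintype X] [DecidableEq X] [Fintype Y]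
    [Fintype Z] [DecidableEq Z]
    (E : Matrix (X × Y) (X × Y) ℂ) (F : Matrix (Y × Z) (Y × Z) ℂ) (a b : X × Z) :
    linkProduct E F a b =
      ∑ y : Y, ((relabel (fun t : X × Y × Z => ((t.1, t.2.1), t.2.2)) (E ⊗ₖ (1 : Matrix Z Z ℂ)))
        * ((1 : Matrix X X ℂ) ⊗ₖ partialTransposeFst F)) (a.1, y, a.2) (b.1, y, b.2) := by
  simp [linkProduct, relabel, partialTransposeFst, Matrix.mul_apply, Fintype.sum_prod_type,
    Matrix.one_apply]

/-! ### Superchannels with one slot -/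

section OneSlot

variable {P AI AO F : Type} [Fintype P] [DecidableEq P] [Fintype AI] [DecidableEq AI]
  [Fintype AO] [DecidableEq AO] [Fintype F]

/-- The link product `S * E` of the Choi operator `S` of a supermap
`[L(AI) → L(AO)] → [L(P) → L(F)]` with the Choi operator `E` of a map
`L(AI ⊗ AI') → L(AO ⊗ AO')`, as a Choi operator for `L(P ⊗ AI') → L(F ⊗ AO')`. -/
def plugOne {P AI AO F AI' AO' : Type} [Fintype AI] [Fintype AO]
    (S : Matrix ((P × AO) × (AI × F)) ((P × AO) × (AI × F)) ℂ)
    (E : Matrix ((AI × AI') × (AO × AO')) ((AI × AI') × (AO × AO')) ℂ) :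
    Matrix ((P × AI') × (F × AO')) ((P × AI') × (F × AO')) ℂ :=
  relabel (fun x : (P × AI') × (F × AO') => ((x.1.1, x.2.1), (x.1.2, x.2.2)))
    (linkProduct
      (relabel (fun x : (P × F) × (AI × AO) => ((x.1.1, x.2.2), (x.2.1, x.1.2))) S)
      (relabel (fun x : (AI × AO) × (AI' × AO') => ((x.1.1, x.2.1), (x.1.2, x.2.2))) E))

/-- Quantum superchannels with one slot (equivalently, by definition, quantum combs with one slot),
through their Choi operators on `(P ⊗ AO) ⊗ (AI ⊗ F)`. -/
def IsSuperchannelOne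
    (S : Matrix ((P × AO) × (AI × F)) ((P × AO) × (AI × F)) ℂ) : Prop :=
  ∀ (AI' AO' : Type) [Fintype AI'] [DecidableEq AI'] [Fintype AO'] [DecidableEq AO']
    (E : Matrix ((AI × AI') × (AO × AO')) ((AI × AI') × (AO × AO')) ℂ),
    IsChannelChoi E → IsChannelChoi (plugOne S E)

end OneSlot

/-! ### Superchannels with two slots (bipartite process matrices) -/

/-- Operators on `(P ⊗ AO ⊗ BO) ⊗ (AI ⊗ BI ⊗ F)`: Choi operators of supermaps
`[L(AI) → L(AO)] ⊗ [L(BI) → L(BO)] → [L(P) → L(F)]`. Here `P` is the global past, `F` the global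
future, `AI`, `AO` the input and output of the first party, `BI`, `BO` those of the second. -/
abbrev ProcOp (P AI AO BI BO F : Type) : Type :=
  Matrix ((P × AO × BO) × (AI × BI × F)) ((P × AO × BO) × (AI × BI × F)) ℂ

/-- The link product `W * (EA ⊗ EB)`, with `EA`, `EB` Choi operators of maps
`L(AI ⊗ AI') → L(AO ⊗ AO')` and `L(BI ⊗ BI') → L(BO ⊗ BO')`, as a Choi operator for
`L(P ⊗ AI' ⊗ BI') → L(F ⊗ AO' ⊗ BO')`. -/
def plugTwo {P AI AO BI BO F AI' AO' BI' BO' : Type}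
    [Fintype AI] [Fintype AO] [Fintype BI] [Fintype BO]
    (W : ProcOp P AI AO BI BO F)
    (EA : Matrix ((AI × AI') × (AO × AO')) ((AI × AI') × (AO × AO')) ℂ)
    (EB : Matrix ((BI × BI') × (BO × BO')) ((BI × BI') × (BO × BO')) ℂ) :
    Matrix ((P × AI' × BI') × (F × AO' × BO')) ((P × AI' × BI') × (F × AO' × BO')) ℂ :=
  relabel (fun x : (P × AI' × BI') × (F × AO' × BO') =>
      ((x.1.1, x.2.1), (x.1.2.1, x.2.2.1), (x.1.2.2, x.2.2.2)))
    (linkProduct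
      (relabel (fun x : (P × F) × ((AI × AO) × (BI × BO)) =>
        ((x.1.1, x.2.1.2, x.2.2.2), (x.2.1.1, x.2.2.1, x.1.2))) W)
      (relabel (fun x : ((AI × AO) × (BI × BO)) × ((AI' × AO') × (BI' × BO')) =>
        (((x.1.1.1, x.2.1.1), (x.1.1.2, x.2.1.2)), ((x.1.2.1, x.2.2.1), (x.1.2.2, x.2.2.2))))
        (EA ⊗ₖ EB)))

section TwoSlots

variable {P AI AO BI BO F : Type} [Fintype P] [DecidableEq P] [Fintype AI] [DecidableEq AI]
  [Fintype AO] [DecidableEq AO] [Fintype BI] [DecidableEq BI] [Fintype BO] [DecidableEq BO]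
  [Fintype F] [DecidableEq F]

/-- Quantum superchannels with two slots, i.e. bipartite process matrices with global past `P` and
global future `F`: two channels acting on the slots and on arbitrary ancillas are sent to a
channel. -/
def IsProcess (W : ProcOp P AI AO BI BO F) : Prop :=
  ∀ (AI' AO' BI' BO' : Type) [Fintype AI'] [DecidableEq AI'] [Fintype AO'] [DecidableEq AO']
    [Fintype BI'] [DecidableEq BI'] [Fintype BO'] [DecidableEq BO']
    (EA : Matrix ((AI × AI') × (AO × AO')) ((AI × AI') × (AO × AO')) ℂ)
    (EB : Matrix ((BI × BI') × (BO × BO')) ((BI × BI') × (BO × BO')) ℂ),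
    IsChannelChoi EA → IsChannelChoi EB → IsChannelChoi (plugTwo W EA EB)

/-- Pure processes: superchannels sending pairs of unitary channels, on the slots and arbitrary
ancillas, to unitary channels. -/
def IsPure (W : ProcOp P AI AO BI BO F) : Prop :=
  IsProcess W ∧
  ∀ (AI' AO' BI' BO' : Type) [Fintype AI'] [DecidableEq AI'] [Fintype AO'] [DecidableEq AO']
    [Fintype BI'] [DecidableEq BI'] [Fintype BO'] [DecidableEq BO']
    (UA : Matrix (AO × AO') (AI × AI') ℂ) (UB : Matrix (BO × BO') (BI × BI') ℂ),
    IsUnitary UA → IsUnitary UB →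
      ∃ UG : Matrix (F × AO' × BO') (P × AI' × BI') ℂ,
        IsUnitary UG ∧ dketbra UG = plugTwo W (dketbra UA) (dketbra UB)

/-- The link product `W' * (|ψ⟩⟨ψ| ⊗ 1)`: insert the state `ψ` in the subsystem `Ps` of the global
past and trace out the subsystem `Fs` of the global future. -/
def insertAndTrace {P AI AO BI BO F Ps Fs : Type} [Fintype Ps] [Fintype Fs] [DecidableEq Fs]
    (W' : ProcOp (P × Ps) AI AO BI BO (F × Fs)) (ψ : Ps → ℂ) : ProcOp P AI AO BI BO F :=
  relabel (fun x => (x, ()))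
    (linkProduct
      (relabel (fun x : ((P × AO × BO) × (AI × BI × F)) × (Ps × Fs) =>
        (((x.1.1.1, x.2.1), x.1.1.2), (x.1.2.1, x.1.2.2.1, (x.1.2.2.2, x.2.2)))) W')
      (relabel (fun x : (Ps × Fs) × Unit => x.1)
        (Matrix.vecMulVec ψ (star ψ) ⊗ₖ (1 : Matrix Fs Fs ℂ))))

/-- Purifiable processes: those obtained from a pure process by inserting a fixed pure state in a
subsystem of the global past and tracing out a subsystem of the global future. -/
def IsPurifiable (W : ProcOp P AI AO BI BO F) : Prop :=
  ∃ (m n : ℕ) (W' : ProcOp (P × Fin m) AI AO BI BO (F × Fin n)) (ψ : Fin m → ℂ),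
    IsPure W' ∧ star ψ ⬝ᵥ ψ = 1 ∧ W = insertAndTrace W' ψ

/-- The link product `R * S` of a two-slot operator `R` with the Choi operator `S` of a one-slot
supermap `[L(AO) → L(BI)] → [L(AI ⊗ AI') → L(BO ⊗ BO')]`, as a Choi operator for
`L(P ⊗ AI') → L(F ⊗ BO')`. -/
def plugComb {P AI AO BI BO F AI' BO' : Type}
    [Fintype AI] [Fintype AO] [Fintype BI] [Fintype BO]
    (R : ProcOp P AI AO BI BO F)
    (S : Matrix (((AI × AI') × BI) × (AO × (BO × BO'))) (((AI × AI') × BI) × (AO × (BO × BO'))) ℂ) :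
    Matrix ((P × AI') × (F × BO')) ((P × AI') × (F × BO')) ℂ :=
  relabel (fun x : (P × AI') × (F × BO') => ((x.1.1, x.2.1), (x.1.2, x.2.2)))
    (linkProduct
      (relabel (fun x : (P × F) × (AI × AO × BI × BO) =>
        ((x.1.1, x.2.2.1, x.2.2.2.2), (x.2.1, x.2.2.2.1, x.1.2))) R)
      (relabel (fun x : (AI × AO × BI × BO) × (AI' × BO') =>
        (((x.1.1, x.2.1), x.1.2.2.1), (x.1.2.1, (x.1.2.2.2, x.2.2)))) S))

/-- Quantum combs of order `A ≺ B`: two-slot supermaps sending every quantum comb with one slot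
(whose past is the input of `A`, whose slot goes from the output of `A` to the input of `B` and
whose future is the output of `B`, up to ancillas) to a channel. -/
def IsCombAB (R : ProcOp P AI AO BI BO F) : Prop :=
  ∀ (AI' BO' : Type) [Fintype AI'] [DecidableEq AI'] [Fintype BO'] [DecidableEq BO']
    (S : Matrix (((AI × AI') × BI) × (AO × (BO × BO')))
      (((AI × AI') × BI) × (AO × (BO × BO'))) ℂ),
    IsSuperchannelOne S → IsChannelChoi (plugComb R S)

/-- Exchange the names of the two parties. -/
def swapParties {P AI AO BI BO F : Type} (R : ProcOp P AI AO BI BO F) : ProcOp P BI BO AI AO F :=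
  relabel (fun x : (P × BO × AO) × (BI × AI × F) =>
    ((x.1.1, x.1.2.2, x.1.2.1), (x.2.2.1, x.2.1, x.2.2.2))) R

/-- Quantum combs of order `B ≺ A`. -/
def IsCombBA (R : ProcOp P AI AO BI BO F) : Prop := IsCombAB (swapParties R)

/-- Causal separability: `W` is a convex mixture of a process ordered `A ≺ B` and a process ordered
`B ≺ A`. -/
def IsCausallySeparable (W : ProcOp P AI AO BI BO F) : Prop :=
  ∃ (q : ℝ) (W₁ W₂ : ProcOp P AI AO BI BO F), 0 ≤ q ∧ q ≤ 1 ∧ IsCombAB W₁ ∧ IsCombBA W₂ ∧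
    W = (q : ℂ) • W₁ + ((1 - q : ℝ) : ℂ) • W₂

/-- The link product `|K⟩⟩⟨⟨K| * W`: the supermap `W` with the map `ρ ↦ K ρ K†` applied to the
global past first. -/
def precompose {P Q AI AO BI BO F : Type} [Fintype Q] (K : Matrix Q P ℂ)
    (W : ProcOp Q AI AO BI BO F) : ProcOp P AI AO BI BO F :=
  relabel (fun x : (P × AO × BO) × (AI × BI × F) => (x.1.1, (x.1.2, x.2)))
    (linkProduct (dketbra K)
      (relabel (fun x : Q × ((AO × BO) × (AI × BI × F)) => ((x.1, x.2.1), x.2.2)) W))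

/-- Causal separability relative to the global past: the mixture of the two causal orders may be
controlled by the outcome of a two-outcome measurement (with Kraus operators `K₁`, `K₂`) of the
global past. If the global past is trivial, this is a convex mixture with weights `|K₁|²` and
`|K₂|²`. -/
def IsCausallySeparableGivenPast (W : ProcOp P AI AO BI BO F) : Prop :=
  ∃ (K₁ K₂ : Matrix P P ℂ) (W₁ W₂ : ProcOp P AI AO BI BO F),
    K₁ᴴ * K₁ + K₂ᴴ * K₂ = 1 ∧ IsCombAB W₁ ∧ IsCombBA W₂ ∧
      W = precompose K₁ W₁ + precompose K₂ W₂

end TwoSlots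

end ProcessMatrix

end

namespace ProcessMatrix

/-! ### Channels in terms of their Choi operators -/

/-! A pure process is the Choi operator of a unitary `U` from the past and the parties' outputs to
the future and the parties' inputs. Once the future is discarded, the process is described by the
Heisenberg-picture operators `Uᴴ (1 ⊗ N ⊗ M) U`, with `N` on the input of `A` and `M` on the input
of `B`. Each is a product of `Uᴴ (1 ⊗ N ⊗ 1) U` and `Uᴴ (1 ⊗ 1 ⊗ M) U`, which commute.

Normalization on all pairs of channels forbids two things. A party cannot signal to its own input,
so the first factor acts trivially on `AO` and the second on `BO`. Their blocks `α` and `β` are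
therefore operators on the past alone, and every `α` commutes with every `β`
(`IsPure.exists_isFactorized`). Causal loops are excluded too: the part of `α` that feels the output
of `B` (its pairing with traceless matrices) times the part of `β` that feels the output of `A` is
zero.

Consequently the past splits (`exists_projection`). Let `E` project onto the smallest subspace that
contains the ranges of the signalling parts of `β` and is invariant under all `β`. It commutes with
both families, the signalling part of `α` vanishes on `E`, and that of `β` vanishes on `1 - E`. So
the order is `A ≺ B` on `E` and `B ≺ A` on its complement, without cross terms.

Inserting `ψ` is an isometry `V` on the past. A polar decomposition turns `E * V` and `(1 - E) * V`
into Kraus operators on `P` followed by partial isometries. The resulting ordered operators are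
normalized only on a subspace and are completed by a depolarizing process that the Kraus operator
never reaches (`IsFactorized.exists_isCombAB`). -/

/-- The link product is the compression of `E ⊗ F` by the unnormalized maximally entangled vector on
the two copies of `Y`. -/
theorem linkProduct_posSemidef {X Y Z : Type} [Fintype X] [Fintype Y] [Fintype Z]
    {E : Matrix (X × Y) (X × Y) ℂ} {F : Matrix (Y × Z) (Y × Z) ℂ}
    (hE : E.PosSemidef) (hF : F.PosSemidef) : (linkProduct E F).PosSemidef := by
  classical
  let B : Matrix ((X × Y) × (Y × Z)) (X × Z) ℂ := Matrix.of fun t s =>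
    if t.1.1 = s.1 ∧ t.2.2 = s.2 ∧ t.1.2 = t.2.1 then 1 else 0
  suffices h : linkProduct E F = Bᴴ * (E ⊗ₖ F) * B by
    rw [h]; exact (hE.kronecker hF).conjTranspose_mul_mul_same B
  ext a b
  simp only [linkProduct, Matrix.of_apply, Matrix.mul_apply, Matrix.conjTranspose_apply,
    Matrix.kroneckerMap_apply, Fintype.sum_prod_type, B, apply_ite star, star_one, star_zero,
    ite_and, ite_mul, mul_ite, one_mul, mul_one, zero_mul, mul_zero,
    Finset.sum_ite_eq, Finset.sum_ite_eq', Finset.mem_univ, if_true, Finset.sum_ite_irrel,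
    Finset.sum_const_zero]
  rw [Finset.sum_comm]

/-- Choi's theorem. It replaces channels by positivity and a partial-trace condition, the only form
in which they are used below. -/
theorem isChannelChoi_iff {I O : Type} [Fintype I] [DecidableEq I] [Fintype O]
    {C : Matrix (I × O) (I × O) ℂ} :
    IsChannelChoi C ↔
      C.PosSemidef ∧ ∀ i i', ∑ o, C (i, o) (i', o) = if i = i' then 1 else 0 := by
  constructor
  · rintro ⟨E, ⟨hcp, htp⟩, rfl⟩
    refine ⟨?_, fun i i' => ?_⟩
    -- The Choi operator is the image of the maximally entangled vector; the ancilla is a copy of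
    -- `I` renamed as `Fin`.
    · let e := Fintype.equivFin I
      let v : I × Fin (Fintype.card I) → ℂ := fun t => if e t.1 = t.2 then 1 else 0
      have h := (hcp _ _ (Matrix.posSemidef_vecMulVec_self_star v)).submatrix
        (fun a : I × O => (a.2, e a.1))
      suffices h' : choi E = (ampliation E (Fintype.card I)
          (Matrix.vecMulVec v (star v))).submatrix (fun a : I × O => (a.2, e a.1))
          (fun a : I × O => (a.2, e a.1)) by rw [h']; exact h
      ext a b
      simp only [choi, Matrix.of_apply, Matrix.submatrix_apply, ampliation]
      refine congrFun (congrFun (congrArg E ?_) _) _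
      ext i i'
      simp [v, Matrix.vecMulVec_apply, Matrix.single_apply, ite_and, eq_comm]
      split_ifs <;> rfl
    · have := htp (Matrix.single i i' 1)
      rw [Matrix.trace] at this
      simp only [Matrix.diag_apply] at this
      simp only [choi, Matrix.of_apply, this]
      split_ifs with h
      · subst h; simp
      · exact Matrix.trace_single_eq_of_ne _ _ _ h
  · rintro ⟨hC, htr⟩
    let E : Matrix I I ℂ →ₗ[ℂ] Matrix O O ℂ :=
      { toFun := fun X => Matrix.of fun o o' => ∑ i, ∑ i', X i i' * C (i, o) (i', o')
        map_add' := fun X Y => by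
          ext; simp [add_mul, Finset.sum_add_distrib]
        map_smul' := fun c X => by
          ext; simp [Finset.mul_sum, mul_assoc] }
    refine ⟨E, ⟨fun n X hX => ?_, fun X => ?_⟩, ?_⟩
    -- Up to the order of the factors, the ampliation of `E` at `X` is the link product of `X` with
    -- `C`.
    · have h := (linkProduct_posSemidef (hX.submatrix (Prod.swap : Fin n × I → I × Fin n)) hC
        ).submatrix (Prod.swap : O × Fin n → Fin n × O)
      exact h
    · simp only [E, Matrix.trace, Matrix.diag_apply, LinearMap.coe_mk, AddHom.coe_mk,
        Matrix.of_apply]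
      rw [Finset.sum_comm]
      refine Finset.sum_congr rfl fun i _ => ?_
      rw [Finset.sum_comm]
      simp [← Finset.mul_sum, htr]
    · ext a b
      simp [choi, E, Matrix.single_apply, ite_and]

theorem _root_.Matrix.IsHermitian.exists_posSemidef_one_add_smul {n : Type} [Fintype n]
    [DecidableEq n] {D : Matrix n n ℂ} (hD : D.IsHermitian) :
    ∃ ε : ℝ, 0 < ε ∧ (1 + (ε : ℂ) • D).PosSemidef := by
  set c : ℝ := 1 + ∑ i, |hD.eigenvalues i|
  have hc : 0 < c := by positivity
  have hle : ∀ i, 0 ≤ c + hD.eigenvalues i := fun i => by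
    have h1 := Finset.single_le_sum (f := fun i => |hD.eigenvalues i|)
      (fun i _ => abs_nonneg _) (Finset.mem_univ i)
    have h2 := neg_abs_le (hD.eigenvalues i)
    simp only [c]
    linarith
  have key : ((c : ℂ) • (1 : Matrix n n ℂ) + D).PosSemidef := by
    have h := (Matrix.PosSemidef.diagonal (n := n) (R := ℂ)
      (d := fun i => ((c + hD.eigenvalues i : ℝ) : ℂ))
      (fun i => by simpa using Complex.zero_le_real.2 (hle i))).mul_mul_conjTranspose_same
      (hD.eigenvectorUnitary : Matrix n n ℂ)
    convert h using 1
    have h1 : Matrix.diagonal (fun i => ((c + hD.eigenvalues i : ℝ) : ℂ)) =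
        (c : ℂ) • (1 : Matrix n n ℂ) + Matrix.diagonal (RCLike.ofReal ∘ hD.eigenvalues) := by
      rw [Matrix.smul_one_eq_diagonal, Matrix.diagonal_add]
      simp
    conv_lhs => rw [hD.spectral_theorem]
    rw [h1, Matrix.mul_add, Matrix.add_mul, Unitary.conjStarAlgAut_apply]
    congr 1
    rw [Matrix.mul_smul, Matrix.smul_mul, Matrix.mul_one, ← Matrix.star_eq_conjTranspose,
      Unitary.mul_star_self_of_mem hD.eigenvectorUnitary.2]
  refine ⟨c⁻¹, inv_pos.2 hc, ?_⟩
  have h := key.smul (a := ((c⁻¹ : ℝ) : ℂ)) (Complex.zero_le_real.2 (inv_pos.2 hc).le)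
  convert h using 1
  rw [smul_add, smul_smul, ← Complex.ofReal_mul, inv_mul_cancel₀ hc.ne', Complex.ofReal_one,
    one_smul]

theorem isChannelChoi_depolarizing {I O : Type} [Fintype I] [DecidableEq I] [Fintype O]
    [DecidableEq O] [Nonempty O] :
    IsChannelChoi (((Fintype.card O : ℂ)⁻¹) • (1 : Matrix (I × O) (I × O) ℂ)) := by
  refine isChannelChoi_iff.2 ⟨Matrix.PosSemidef.one.smul (by positivity), fun i i' => ?_⟩
  simp [Matrix.one_apply]

/-- A linear functional that is constant on channels annihilates the differences of channels, that
is, all operators with vanishing partial trace over the output. -/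
theorem apply_eq_zero_of_const_on_channels {I O : Type} [Fintype I] [DecidableEq I] [Fintype O]
    [DecidableEq O] [Nonempty O] (f : Matrix (I × O) (I × O) ℂ →ₗ[ℂ] ℂ) (c : ℂ)
    (hf : ∀ C, IsChannelChoi C → f C = c) (D : Matrix (I × O) (I × O) ℂ)
    (hD : ∀ i i', ∑ o, D (i, o) (i', o) = 0) : f D = 0 := by
  have herm : ∀ D : Matrix (I × O) (I × O) ℂ, D.IsHermitian →
      (∀ i i', ∑ o, D (i, o) (i', o) = 0) → f D = 0 := by
    intro D hH hD
    -- The depolarizing channel is interior to the cone of positive operators, so a small Hermitian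
    -- perturbation along `D` is still a channel.
    obtain ⟨ε, hε, hp⟩ := hH.exists_posSemidef_one_add_smul
    have hd : (Fintype.card O : ℂ) ≠ 0 := Nat.cast_ne_zero.2 Fintype.card_ne_zero
    have h0 := hf _ (isChannelChoi_depolarizing (I := I) (O := O))
    have h1 := hf (((Fintype.card O : ℂ)⁻¹) • (1 + (ε : ℂ) • D)) <| by
      refine isChannelChoi_iff.2 ⟨hp.smul (by positivity), fun i i' => ?_⟩
      simp [Matrix.one_apply, ← Finset.mul_sum, Finset.sum_add_distrib, hD]
    rw [smul_add, map_add, h0, map_smul, map_smul] at h1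
    have h2 : (Fintype.card O : ℂ)⁻¹ • (ε : ℂ) • f D = 0 := by
      simpa using h1
    simpa [hε.ne'] using h2
  have hDs : ∀ i i', ∑ o, Dᴴ (i, o) (i', o) = 0 := fun i i' => by
    simp only [Matrix.conjTranspose_apply, ← star_sum, hD, star_zero]
  have h1 : f (D + Dᴴ) = 0 := herm _ (Matrix.isHermitian_add_transpose_self D) fun i i' => by
    simp only [Matrix.add_apply, Finset.sum_add_distrib, hD, hDs, add_zero]
  have h2 : f (Complex.I • (D - Dᴴ)) = 0 := herm _ (by
      rw [Matrix.IsHermitian]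
      simp [Matrix.conjTranspose_smul, ← smul_neg]) fun i i' => by
    simp only [Matrix.smul_apply, Matrix.sub_apply, smul_eq_mul, ← Finset.mul_sum,
      Finset.sum_sub_distrib, hD, hDs, sub_zero, mul_zero]
  rw [map_smul, map_sub, smul_eq_mul, mul_eq_zero, or_iff_right Complex.I_ne_zero] at h2
  rw [map_add] at h1
  linear_combination (1/2) * h1 + (1/2) * h2

/-- The unitary operator that exchanges two tensor factors. -/
def swapOp (X Y : Type) [DecidableEq X] [DecidableEq Y] : Matrix (Y × X) (X × Y) ℂ :=
  Matrix.of fun a b => if a = b.swap then 1 else 0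

theorem isUnitary_swapOp (X Y : Type) [Fintype X] [DecidableEq X] [Fintype Y] [DecidableEq Y] :
    IsUnitary (swapOp X Y) := by
  constructor <;>
  · ext ⟨a, b⟩ ⟨c, d⟩
    simp [swapOp, Matrix.mul_apply, Fintype.sum_prod_type, Matrix.one_apply, ite_and, Prod.ext_iff]
    try grind

theorem isChannelChoi_dketbra {I O : Type} [Fintype I] [DecidableEq I] [Fintype O]
    [DecidableEq O] {U : Matrix O I ℂ} (hU : IsUnitary U) : IsChannelChoi (dketbra U) := by
  refine isChannelChoi_iff.2 ⟨Matrix.posSemidef_vecMulVec_self_star _, fun i i' => ?_⟩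
  have h := congrFun (congrFun hU.1 i') i
  rw [Matrix.mul_apply, Matrix.one_apply] at h
  simp only [dketbra, Matrix.vecMulVec_apply, choiVec, Pi.star_apply, eq_comm (a := i)]
  rw [← h]
  exact Finset.sum_congr rfl fun o _ => mul_comm _ _

/-! ### Linear conditions on channels, superchannels and processes -/

/-- An array of coefficients that pairs to zero with all traceless matrices is scalar. -/
theorem eq_ite_of_pairing_traceless {O : Type} [Fintype O] [DecidableEq O] {g : O → O → ℂ}
    (h : ∀ X : Matrix O O ℂ, X.trace = 0 → ∑ o, ∑ o', g o o' * X o o' = 0) (o₀ o o' : O) :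
    g o o' = if o = o' then g o₀ o₀ else 0 := by
  split_ifs with ho
  · subst ho
    have := h (Matrix.single o o 1 - Matrix.single o₀ o₀ 1) (by simp [Matrix.trace_sub])
    simp only [Matrix.sub_apply, mul_sub, Finset.sum_sub_distrib, Matrix.single_apply, ite_and,
      mul_ite, mul_one, mul_zero, Finset.sum_ite_eq, Finset.mem_univ, if_true,
      Finset.sum_ite_irrel, Finset.sum_const_zero] at this
    exact sub_eq_zero.1 this
  · have := h (Matrix.single o o' 1) (Matrix.trace_single_eq_of_ne _ _ _ ho)
    simpa [Matrix.single_apply, ite_and] using this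

section ConstOnChannels

variable {I O : Type} [Fintype I] [DecidableEq I] [Fintype O] [DecidableEq O] [Nonempty O]
  {T : I × O → I × O → ℂ} {c : ℂ}

theorem pairing_traceless_eq_zero
    (hT : ∀ C : Matrix (I × O) (I × O) ℂ, IsChannelChoi C → ∑ y, ∑ y', T y y' * C y y' = c)
    (i i' : I) (X : Matrix O O ℂ) (hX : X.trace = 0) :
    ∑ o, ∑ o', T (i, o) (i', o') * X o o' = 0 := by
  let f : Matrix (I × O) (I × O) ℂ →ₗ[ℂ] ℂ :=
    { toFun := fun C => ∑ y, ∑ y', T y y' * C y y'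
      map_add' := fun C D => by simp [mul_add, Finset.sum_add_distrib]
      map_smul' := fun r C => by simp [Finset.mul_sum, mul_left_comm] }
  have h := apply_eq_zero_of_const_on_channels f c hT (Matrix.single i i' 1 ⊗ₖ X) fun k k' => by
    simpa [← Finset.mul_sum, Matrix.trace] using Or.inr hX
  simpa [f, Fintype.sum_prod_type, Matrix.single_apply, ite_and, Finset.sum_ite_irrel] using h

/-- The diagonal of `T` does not depend on the output index, so evaluation at the depolarizing
channel gives the constant. -/
theorem sum_diag_eq
    (hT : ∀ C : Matrix (I × O) (I × O) ℂ, IsChannelChoi C → ∑ y, ∑ y', T y y' * C y y' = c)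
    (o₀ : O) : ∑ i, T (i, o₀) (i, o₀) = c := by
  have h := hT _ isChannelChoi_depolarizing
  have h1 : ∀ i o, T (i, o) (i, o) = T (i, o₀) (i, o₀) := fun i o => by
    simpa using eq_ite_of_pairing_traceless (g := fun o o' => T (i, o) (i, o'))
      (pairing_traceless_eq_zero hT i i) o₀ o o
  have hd : (Fintype.card O : ℂ) ≠ 0 := Nat.cast_ne_zero.2 Fintype.card_ne_zero
  simp only [Matrix.smul_apply, Matrix.one_apply, smul_eq_mul, mul_ite, mul_one, mul_zero,
    Finset.sum_ite_eq, Finset.mem_univ, if_true, Fintype.sum_prod_type, h1, Finset.sum_const,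
    Finset.card_univ, nsmul_eq_mul] at h
  rw [← h]
  refine Finset.sum_congr rfl fun i _ => ?_
  field_simp

end ConstOnChannels

section ConstOnPairs

variable {AI AO BI BO : Type} [Fintype AI] [DecidableEq AI] [Fintype AO] [DecidableEq AO]
  [Nonempty AO] [Fintype BI] [DecidableEq BI] [Fintype BO]
  {T : AI × AO → AI × AO → BI × BO → BI × BO → ℂ} {c : ℂ}

theorem pairing_traceless_left
    (hT : ∀ EA EB, IsChannelChoi EA → IsChannelChoi EB →
      ∑ y, ∑ y', ∑ z, ∑ z', T y y' z z' * EA y y' * EB z z' = c)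
    (i i' : AI) (X : Matrix AO AO ℂ) (hX : X.trace = 0) (EB : Matrix (BI × BO) (BI × BO) ℂ)
    (hB : IsChannelChoi EB) :
    ∑ z, ∑ z', (∑ a, ∑ a', T (i, a) (i', a') z z' * X a a') * EB z z' = 0 := by
  have h := pairing_traceless_eq_zero (T := fun y y' => ∑ z, ∑ z', T y y' z z' * EB z z')
    (c := c) (fun EA hA => by
      rw [← hT EA EB hA hB]
      simp only [Finset.sum_mul]
      simp only [mul_right_comm]) i i' X hX
  rw [← h]
  simp only [Finset.sum_mul]
  calc _ = ∑ z, ∑ a, ∑ z', ∑ a', T (i, a) (i', a') z z' * X a a' * EB z z' :=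
        Finset.sum_congr rfl fun z _ => Finset.sum_comm
    _ = ∑ a, ∑ z, ∑ z', ∑ a', T (i, a) (i', a') z z' * X a a' * EB z z' := Finset.sum_comm
    _ = ∑ a, ∑ z, ∑ a', ∑ z', T (i, a) (i', a') z z' * X a a' * EB z z' :=
        Finset.sum_congr rfl fun a _ => Finset.sum_congr rfl fun z _ => Finset.sum_comm
    _ = ∑ a, ∑ a', ∑ z, ∑ z', T (i, a) (i', a') z z' * X a a' * EB z z' :=
        Finset.sum_congr rfl fun a _ => Finset.sum_comm
    _ = _ := by simp only [mul_right_comm]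

variable [DecidableEq BO] [Nonempty BO]

/-- This is the absence of two-party causal loops: both outputs cannot influence the opposite inputs
at once. -/
theorem pairing_traceless_both
    (hT : ∀ EA EB, IsChannelChoi EA → IsChannelChoi EB →
      ∑ y, ∑ y', ∑ z, ∑ z', T y y' z z' * EA y y' * EB z z' = c)
    (i i' : AI) (j j' : BI) {X : Matrix AO AO ℂ} (hX : X.trace = 0) {Y : Matrix BO BO ℂ}
    (hY : Y.trace = 0) :
    ∑ b, ∑ b', (∑ a, ∑ a', T (i, a) (i', a') (j, b) (j', b') * X a a') * Y b b' = 0 :=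
  pairing_traceless_eq_zero (pairing_traceless_left hT i i' X hX) j j' Y hY

/-- With the input of `B` discarded, the input of `A` is independent of the output of `A`. For
traceless `X` the pairing is a functional vanishing on all channels of `B`, and `sum_diag_eq` with
constant zero applies to it. -/
theorem sum_input_eq_ite
    (hT : ∀ EA EB, IsChannelChoi EA → IsChannelChoi EB →
      ∑ y, ∑ y', ∑ z, ∑ z', T y y' z z' * EA y y' * EB z z' = c)
    (i i' : AI) (a₀ a a' : AO) (b b' : BO) :
    ∑ j, T (i, a) (i', a') (j, b) (j, b') =
      if a = a' then ∑ j, T (i, a₀) (i', a₀) (j, b) (j, b') else 0 := by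
  refine eq_ite_of_pairing_traceless
    (g := fun a a' => ∑ j, T (i, a) (i', a') (j, b) (j, b')) (fun X hX => ?_) a₀ a a'
  have h := pairing_traceless_left hT i i' X hX
  have h1 : ∀ j, ∑ a, ∑ a', T (i, a) (i', a') (j, b) (j, b') * X a a' =
      if b = b' then ∑ a, ∑ a', T (i, a) (i', a') (j, b) (j, b) * X a a' else 0 := fun j =>
    eq_ite_of_pairing_traceless
      (g := fun b b' => ∑ a, ∑ a', T (i, a) (i', a') (j, b) (j, b') * X a a')
      (pairing_traceless_eq_zero h j j) b b b'
  calc _ = ∑ j, ∑ a, ∑ a', T (i, a) (i', a') (j, b) (j, b') * X a a' := by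
        simp only [Finset.sum_mul]
        exact (Finset.sum_congr rfl fun a _ => Finset.sum_comm).trans Finset.sum_comm
    _ = 0 := by
        simp only [h1]
        split_ifs
        · exact sum_diag_eq h b
        · simp

end ConstOnPairs

section Superchannel

variable {P AI AO F : Type} [Fintype P] [DecidableEq P] [Fintype AI] [DecidableEq AI]
  [Fintype AO] [DecidableEq AO] [Fintype F]
  {S : Matrix ((P × AO) × (AI × F)) ((P × AO) × (AI × F)) ℂ}

/-- Plugging in the swap of slot and ancilla returns `S` itself, up to the order of the factors. -/
theorem IsSuperchannelOne.posSemidef (hS : IsSuperchannelOne S) : S.PosSemidef := by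
  have h := (isChannelChoi_iff.1 (hS AO AI _ (isChannelChoi_dketbra (isUnitary_swapOp AI AO)))).1
  have h' := h.submatrix
    (fun x : (P × AO) × (AI × F) => ((x.1.1, x.1.2), (x.2.2, x.2.1)))
  suffices S = (plugOne S (dketbra (swapOp AI AO))).submatrix
      (fun x : (P × AO) × (AI × F) => ((x.1.1, x.1.2), (x.2.2, x.2.1)))
      (fun x : (P × AO) × (AI × F) => ((x.1.1, x.1.2), (x.2.2, x.2.1))) by
    rw [this]; exact h'
  ext ⟨⟨p, a⟩, i, f⟩ ⟨⟨p', a'⟩, i', f'⟩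
  simp [plugOne, relabel, linkProduct, dketbra, swapOp, Matrix.vecMulVec_apply, choiVec,
    Fintype.sum_prod_type, ite_and, apply_ite (starRingEnd ℂ)]

/-- With trivial ancillas and the future traced out, `S` is a functional that is constant on
channels. This yields the two normalization conditions of a one-slot comb. -/
theorem IsSuperchannelOne.exists_marginal [Nonempty AO] (hS : IsSuperchannelOne S) :
    ∃ S' : Matrix (P × AI) (P × AI) ℂ,
      (∀ p o i p' o' i', ∑ f, S ((p, o), (i, f)) ((p', o'), (i', f)) =
        if o = o' then S' (p, i) (p', i') else 0) ∧
      ∀ p p', ∑ i, S' (p, i) (p', i) = if p = p' then 1 else 0 := by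
  obtain ⟨o₀⟩ := ‹Nonempty AO›
  have : Nonempty AO := ⟨o₀⟩
  have key : ∀ p p', ∀ C : Matrix (AI × AO) (AI × AO) ℂ, IsChannelChoi C →
      ∑ y, ∑ y', (∑ f, S ((p, y.2), (y.1, f)) ((p', y'.2), (y'.1, f))) * C y y' =
        if p = p' then 1 else 0 := by
    intro p p' C hC
    have hE : IsChannelChoi
        (C.submatrix (fun x : (AI × Unit) × (AO × Unit) => (x.1.1, x.2.1))
          (fun x : (AI × Unit) × (AO × Unit) => (x.1.1, x.2.1))) := by
      obtain ⟨h1, h2⟩ := isChannelChoi_iff.1 hC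
      refine isChannelChoi_iff.2 ⟨h1.submatrix _, fun i i' => ?_⟩
      simpa [Fintype.sum_prod_type, Prod.ext_iff] using h2 i.1 i'.1
    have h := (isChannelChoi_iff.1 (hS Unit Unit _ hE)).2 (p, ()) (p', ())
    simp only [plugOne, relabel, linkProduct, Matrix.submatrix_apply, Matrix.of_apply,
      Prod.mk.injEq, and_true] at h
    rw [← h]
    conv_rhs => rw [Fintype.sum_prod_type]
    simp only [Finset.univ_unique, Finset.sum_singleton, Finset.sum_mul]
    exact (Finset.sum_congr rfl fun y _ => Finset.sum_comm).trans Finset.sum_comm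
  refine ⟨Matrix.of fun x x' => ∑ f, S ((x.1, o₀), (x.2, f)) ((x'.1, o₀), (x'.2, f)),
    fun p o i p' o' i' => ?_, fun p p' => ?_⟩
  · exact eq_ite_of_pairing_traceless
      (g := fun o o' => ∑ f, S ((p, o), (i, f)) ((p', o'), (i', f)))
      (pairing_traceless_eq_zero (key p p') i i') o₀ o o'
  · exact sum_diag_eq (key p p') o₀

end Superchannel

/-! ### A sufficient condition for quantum combs -/

section Ordered

variable {P AI AO BI BO : Type}

/-- Operators `R` of the order `A ≺ B`, up to the normalization, which is given by an operator `t`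
on the global past: the input of `A` depends on the past alone and the input of `B` does not depend
on the output of `B`. -/
structure IsOrdered [Fintype AI] [Fintype BI] [DecidableEq AO] [DecidableEq BO]
    (R : ProcOp P AI AO BI BO Unit) (t : Matrix P P ℂ) : Prop where
  posSemidef : R.PosSemidef
  exists_marginals : ∃ (R₂ : P → AO → AI → BI → P → AO → AI → BI → ℂ)
    (R₁ : P → AI → P → AI → ℂ),
    (∀ p a b i j p' a' b' i' j', R ((p, a, b), (i, j, ())) ((p', a', b'), (i', j', ())) =
      if b = b' then R₂ p a i j p' a' i' j' else 0) ∧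
    (∀ p a i p' a' i', ∑ j, R₂ p a i j p' a' i' j = if a = a' then R₁ p i p' i' else 0) ∧
    ∀ p p', ∑ i, R₁ p i p' i = t p' p

theorem IsOrdered.add [Fintype AI] [Fintype BI] [DecidableEq AO] [DecidableEq BO]
    {R R' : ProcOp P AI AO BI BO Unit} {t t' : Matrix P P ℂ}
    (h : IsOrdered R t) (h' : IsOrdered R' t') : IsOrdered (R + R') (t + t') := by
  obtain ⟨R₂, R₁, h2, h1, h0⟩ := h.exists_marginals
  obtain ⟨R₂', R₁', h2', h1', h0'⟩ := h'.exists_marginals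
  refine ⟨h.posSemidef.add h'.posSemidef,
    fun p a i j p' a' i' j' => R₂ p a i j p' a' i' j' + R₂' p a i j p' a' i' j',
    fun p i p' i' => R₁ p i p' i' + R₁' p i p' i', ?_, ?_, ?_⟩
  · intros
    rw [Matrix.add_apply, h2, h2']
    split_ifs <;> simp
  · intros
    rw [Finset.sum_add_distrib, h1, h1']
    split_ifs <;> simp
  · intros
    rw [Finset.sum_add_distrib, h0, h0', Matrix.add_apply]

variable [Fintype P] [DecidableEq P] [Fintype AI] [DecidableEq AI]
  [Fintype AO] [DecidableEq AO] [Fintype BI] [DecidableEq BI] [Fintype BO] [DecidableEq BO]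

/-- Measure the past with the effect `t` and give the parties maximally mixed states. -/
noncomputable def depolarizingProcess (P AI AO BI BO : Type) [DecidableEq AI] [Fintype AI] [DecidableEq AO]
    [DecidableEq BI] [Fintype BI] [DecidableEq BO] (t : Matrix P P ℂ) :
    ProcOp P AI AO BI BO Unit :=
  (((Fintype.card AI : ℂ)⁻¹ * (Fintype.card BI : ℂ)⁻¹)) •
    (tᵀ ⊗ₖ (1 : Matrix (AO × BO) (AO × BO) ℂ)) ⊗ₖ
      (1 : Matrix (AI × BI × Unit) (AI × BI × Unit) ℂ)

omit [DecidableEq P] in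
theorem isOrdered_depolarizingProcess [Nonempty AI] [Nonempty BI] {t : Matrix P P ℂ}
    (ht : t.PosSemidef) : IsOrdered (depolarizingProcess P AI AO BI BO t) t := by
  have hA : (Fintype.card AI : ℂ) ≠ 0 := Nat.cast_ne_zero.2 Fintype.card_ne_zero
  have hB : (Fintype.card BI : ℂ) ≠ 0 := Nat.cast_ne_zero.2 Fintype.card_ne_zero
  refine ⟨(((ht.transpose).kronecker .one).kronecker .one).smul (by positivity),
    fun p a i j p' a' i' j' => if a = a' ∧ i = i' ∧ j = j' then
      (Fintype.card AI : ℂ)⁻¹ * (Fintype.card BI : ℂ)⁻¹ * t p' p else 0,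
    fun p i p' i' => if i = i' then (Fintype.card AI : ℂ)⁻¹ * t p' p else 0, ?_, ?_, ?_⟩
  · intros
    simp only [depolarizingProcess, Matrix.smul_apply, Matrix.kroneckerMap_apply,
      Matrix.one_apply, Matrix.transpose_apply, Prod.mk.injEq, smul_eq_mul]
    split_ifs <;> simp_all
  · intros
    simp only [ite_and, Finset.sum_ite_irrel, Finset.sum_const_zero]
    simp only [Finset.sum_const]
    split_ifs <;> simp [field]
  · intros
    simp [hA]

/-- The normalizations of `R` and `S` are used alternately, backwards in time: tracing the output of
`B`, then its input, then the output of `A`, then its input, each identity produced on one side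
allows the next trace on the other. -/
theorem IsOrdered.isCombAB [Nonempty BI] {R : ProcOp P AI AO BI BO Unit}
    (hR : IsOrdered R 1) : IsCombAB R := by
  intro AI' BO' _ _ _ _ S hS
  obtain ⟨R₂, R₁, h2, h1, h0⟩ := hR.exists_marginals
  obtain ⟨S', hS1, hS0⟩ := hS.exists_marginal
  refine isChannelChoi_iff.2 ⟨?_, ?_⟩
  · exact (linkProduct_posSemidef (hR.posSemidef.submatrix _)
      (hS.posSemidef.submatrix _)).submatrix _
  · rintro ⟨p, x⟩ ⟨p', x'⟩
    have e1 : ∑ o : Unit × BO', plugComb R S ((p, x), o) ((p', x'), o) =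
        ∑ i, ∑ a, ∑ j, ∑ i', ∑ a', ∑ j', R₂ p a i j p' a' i' j' *
          ∑ b, ∑ y, S (((i, x), j), (a, (b, y))) (((i', x'), j'), (a', (b, y))) := by
      rw [Fintype.sum_prod_type]
      simp only [plugComb, relabel, linkProduct, Matrix.submatrix_apply, Matrix.of_apply,
        Finset.univ_unique, Finset.sum_singleton, PUnit.default_eq_unit]
      refine (Finset.sum_comm.trans (Finset.sum_congr rfl fun t _ => Finset.sum_comm)).trans ?_
      simp only [Fintype.sum_prod_type, h2, ite_mul, zero_mul, Finset.sum_ite_irrel,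
        Finset.sum_const_zero, Finset.sum_ite_eq, Finset.mem_univ, if_true, Finset.mul_sum]
      refine Finset.sum_congr rfl fun i _ => Finset.sum_congr rfl fun a _ =>
        Finset.sum_congr rfl fun j _ => ?_
      rw [Finset.sum_comm]
      refine Finset.sum_congr rfl fun i' _ => ?_
      rw [Finset.sum_comm]
      refine Finset.sum_congr rfl fun a' _ => ?_
      rw [Finset.sum_comm]
    have e2 : ∀ i a j i' a' j',
        ∑ b, ∑ y, S (((i, x), j), (a, (b, y))) (((i', x'), j'), (a', (b, y))) =
          if j = j' then S' ((i, x), a) ((i', x'), a') else 0 := fun i a j i' a' j' => by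
      rw [← hS1, Fintype.sum_prod_type]
    have e3 : ∀ i i', ∑ a, ∑ j, ∑ a', ∑ j', R₂ p a i j p' a' i' j' *
        (if j = j' then S' ((i, x), a) ((i', x'), a') else 0) =
          R₁ p i p' i' * if i = i' ∧ x = x' then 1 else 0 := fun i i' => by
      simp only [mul_ite, mul_zero, Finset.sum_ite_eq, Finset.mem_univ, if_true]
      have : ∀ a, ∑ j, ∑ a', R₂ p a i j p' a' i' j * S' ((i, x), a) ((i', x'), a') =
          R₁ p i p' i' * S' ((i, x), a) ((i', x'), a) := fun a => by
        rw [Finset.sum_comm]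
        simp [← Finset.sum_mul, h1]
      simp only [this, ← Finset.mul_sum, hS0, Prod.mk.injEq, mul_ite, mul_one, mul_zero]
    rw [e1]
    simp only [e2]
    calc _ = ∑ i, ∑ i', ∑ a, ∑ j, ∑ a', ∑ j', R₂ p a i j p' a' i' j' *
          (if j = j' then S' ((i, x), a) ((i', x'), a') else 0) := by
          exact Finset.sum_congr rfl fun i _ =>
            (Finset.sum_congr rfl fun a _ => Finset.sum_comm).trans Finset.sum_comm
      _ = if (p, x) = (p', x') then 1 else 0 := by
          simp_rw [e3]
          simp only [ite_and, mul_ite, mul_one, mul_zero, Finset.sum_ite_eq, Finset.mem_univ,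
            if_true, Finset.sum_ite_irrel, Finset.sum_const_zero]
          simp only [h0, Matrix.one_apply, Prod.mk.injEq, ← ite_and]
          simp only [and_comm, eq_comm]

end Ordered

/-! ### Linear algebra on the global past -/

/-- A polar decomposition: every `V` factors as `R * K` with `Kᴴ * K = Vᴴ * V` and
`R = V * Z` a partial isometry with initial space the range of `K`. -/
theorem exists_partialIsometry_mul {P Q : Type} [Fintype P] [DecidableEq P] [Fintype Q]
    (V : Matrix Q P ℂ) :
    ∃ (K : Matrix P P ℂ) (Z : Matrix P P ℂ), V * Z * K = V ∧ Kᴴ * K = Vᴴ * V ∧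
      (1 - (V * Z)ᴴ * (V * Z)).PosSemidef ∧ (1 - (V * Z)ᴴ * (V * Z)) * K = 0 := by
  have hp := Matrix.posSemidef_conjTranspose_mul_self V
  set ev := hp.isHermitian.eigenvalues with hev
  set U : Matrix P P ℂ := (hp.isHermitian.eigenvectorUnitary : Matrix P P ℂ)
  have hU : Uᴴ * U = 1 := Unitary.star_mul_self_of_mem hp.isHermitian.eigenvectorUnitary.2
  have hU' : U * Uᴴ = 1 := Unitary.mul_star_self_of_mem hp.isHermitian.eigenvectorUnitary.2
  have hspec : Vᴴ * V = U * Matrix.diagonal (fun i => (ev i : ℂ)) * Uᴴ := by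
    have := hp.isHermitian.spectral_theorem
    rwa [Unitary.conjStarAlgAut_apply] at this
  have hnn : ∀ i, 0 ≤ ev i := hp.eigenvalues_nonneg
  set s : P → ℂ := fun i => ((√(ev i) : ℝ) : ℂ)
  have hs : ∀ i, s i * s i = ev i := fun i => by
    simp only [s]; rw [← Complex.ofReal_mul, Real.mul_self_sqrt (hnn i)]
  have hstar : ∀ i, star (s i) = s i := fun i => Complex.conj_ofReal _
  -- Since `0⁻¹ = 0`, the diagonal of `(s i)⁻¹` is a pseudo-inverse of that of `s`, and `k` marks
  -- the defect, the kernel of `V`.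
  set k : P → ℂ := fun i => if s i = 0 then 1 else 0
  have hks : ∀ i, k i * s i = 0 := fun i => by
    simp only [k]
    split_ifs with h <;> simp [h]
  have hgram : (V * (U * Matrix.diagonal fun i => (s i)⁻¹))ᴴ *
      (V * (U * Matrix.diagonal fun i => (s i)⁻¹)) = 1 - Matrix.diagonal k := by
    calc _ = (Matrix.diagonal fun i => (s i)⁻¹)ᴴ * (Uᴴ * (Vᴴ * V) * U) *
          (Matrix.diagonal fun i => (s i)⁻¹) := by
          simp only [Matrix.conjTranspose_mul, Matrix.mul_assoc]
      _ = (Matrix.diagonal fun i => (s i)⁻¹)ᴴ * ((Uᴴ * U) * Matrix.diagonal (fun i => (ev i : ℂ))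
          * (Uᴴ * U)) * (Matrix.diagonal fun i => (s i)⁻¹) := by
          rw [hspec]; simp only [Matrix.mul_assoc]
      _ = _ := by
          rw [hU, Matrix.one_mul, Matrix.mul_one, Matrix.diagonal_conjTranspose,
            Matrix.diagonal_mul_diagonal, Matrix.diagonal_mul_diagonal, ← Matrix.diagonal_one,
            Matrix.diagonal_sub]
          congr 1
          ext i
          simp only [Pi.star_apply, star_inv₀, hstar, ← hs, k]
          split_ifs with h
          · simp [h]
          · field_simp; simp
  have hker : V * (U * Matrix.diagonal k) = 0 := by
    rw [← Matrix.conjTranspose_mul_self_eq_zero]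
    calc _ = (Matrix.diagonal k)ᴴ * (Uᴴ * (Vᴴ * V) * U) * (Matrix.diagonal k) := by
          simp only [Matrix.conjTranspose_mul, Matrix.mul_assoc]
      _ = (Matrix.diagonal k)ᴴ * ((Uᴴ * U) * Matrix.diagonal (fun i => (ev i : ℂ))
          * (Uᴴ * U)) * (Matrix.diagonal k) := by
          rw [hspec]; simp only [Matrix.mul_assoc]
      _ = 0 := by
          rw [hU, Matrix.one_mul, Matrix.mul_one, Matrix.mul_assoc, Matrix.diagonal_mul_diagonal]
          have : (fun i => (ev i : ℂ) * k i) = 0 := by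
            ext i
            rw [← hs, mul_assoc, mul_comm (s i) (k i), hks]; simp
          rw [this]; simp
  refine ⟨Matrix.diagonal s * Uᴴ, U * Matrix.diagonal fun i => (s i)⁻¹, ?_, ?_, ?_, ?_⟩
  · have h1 : (Matrix.diagonal fun i => (s i)⁻¹) * Matrix.diagonal s =
        1 - Matrix.diagonal k := by
      rw [Matrix.diagonal_mul_diagonal, ← Matrix.diagonal_one, Matrix.diagonal_sub]
      congr 1
      ext i
      simp only [k]
      split_ifs with h <;> simp [h]
    calc _ = V * (U * ((Matrix.diagonal fun i => (s i)⁻¹) * Matrix.diagonal s) * Uᴴ) := by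
          simp only [Matrix.mul_assoc]
      _ = V * (U * Uᴴ) - V * (U * Matrix.diagonal k) * Uᴴ := by
          rw [h1]; simp only [Matrix.mul_sub, Matrix.sub_mul, Matrix.mul_assoc, Matrix.mul_one]
      _ = V := by rw [hker, hU']; simp
  · rw [hspec, Matrix.conjTranspose_mul, Matrix.conjTranspose_conjTranspose,
      Matrix.diagonal_conjTranspose]
    calc _ = U * (Matrix.diagonal (star s) * Matrix.diagonal s) * Uᴴ := by
          simp only [Matrix.mul_assoc]
      _ = _ := by
          rw [Matrix.diagonal_mul_diagonal]
          simp only [Pi.star_apply, hstar, hs]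
  · rw [hgram, sub_sub_cancel]
    exact Matrix.PosSemidef.diagonal fun i => by simp only [k]; split_ifs <;> simp
  · rw [hgram, sub_sub_cancel, ← Matrix.mul_assoc, Matrix.diagonal_mul_diagonal]
    simp [hks]

/-- `Q` projects onto the smallest `T`-invariant subspace containing the ranges of `T₀`. Minimality
is tested against subspaces built from `S`, and adjoint-closedness makes the invariant subspace
reducing. -/
theorem exists_projection {P : Type} [Fintype P] [DecidableEq P]
    {S T S₀ T₀ : Set (Matrix P P ℂ)} (hcomm : ∀ s ∈ S, ∀ t ∈ T, Commute s t)
    (hS : ∀ s ∈ S, sᴴ ∈ S) (hT : ∀ t ∈ T, tᴴ ∈ T)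
    (hS₀ : S₀ ⊆ Submodule.span ℂ S) (hT₀ : T₀ ⊆ Submodule.span ℂ T)
    (h₀ : ∀ s ∈ S₀, ∀ t ∈ T₀, s * t = 0) :
    ∃ Q : Matrix P P ℂ, Qᴴ = Q ∧ Q * Q = Q ∧ (∀ s ∈ S, Commute Q s) ∧ (∀ t ∈ T, Commute Q t) ∧
      (∀ s ∈ S₀, s * Q = 0) ∧ ∀ t ∈ T₀, t * (1 - Q) = 0 := by
  have hspan : ∀ {S T : Set (Matrix P P ℂ)}, (∀ s ∈ S, ∀ t ∈ T, Commute s t) →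
      ∀ s ∈ Submodule.span ℂ S, ∀ t ∈ T, Commute s t := by
    intro S T h s hs t ht
    induction hs using Submodule.span_induction with
    | mem x hx => exact h x hx t ht
    | zero => exact Commute.zero_left t
    | add x y _ _ hx hy => exact hx.add_left hy
    | smul c x _ hx => exact hx.smul_left c
  have hcomm' : ∀ t ∈ T, ∀ s ∈ S, Commute t s := fun t ht s hs => (hcomm s hs t ht).symm
  let φ := Matrix.toEuclideanCLM (𝕜 := ℂ) (n := P)
  have hφ : ∀ {s t : Matrix P P ℂ}, Commute s t → ∀ v, φ s (φ t v) = φ t (φ s v) := by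
    intro s t h v
    rw [← mul_apply_eq_comp, ← map_mul, h.eq, map_mul, mul_apply_eq_comp]
  let C : Set (Submodule ℂ (EuclideanSpace ℂ P)) :=
    {V | (∀ t ∈ T₀, ∀ v, φ t v ∈ V) ∧ ∀ t ∈ T, ∀ v ∈ V, φ t v ∈ V}
  let V := sInf C
  have hV : ∀ W ∈ C, V ≤ W := fun W hW => sInf_le hW
  have hVC : V ∈ C := by
    refine ⟨fun t ht v => ?_, fun t ht v hv => ?_⟩ <;> simp only [V, Submodule.mem_sInf] at *
    · exact fun W hW => hW.1 t ht v
    · exact fun W hW => hW.2 t ht v (hv W hW)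
  have hVS : ∀ s ∈ S, ∀ v ∈ V, φ s v ∈ V := by
    intro s hs
    -- The vectors of `V` that `s` sends into `V` again form a member of `C`, because `s` commutes
    -- with `T`; by minimality they are all of `V`.
    refine fun v hv => (hV (V ⊓ V.comap (φ s).toLinearMap) ⟨fun t ht v => ?_, fun t ht v hv => ?_⟩
      hv).2
    · refine ⟨hVC.1 t ht v, ?_⟩
      change φ s (φ t v) ∈ V
      rw [← hφ (hspan hcomm' t (hT₀ ht) s hs)]
      exact hVC.1 t ht _
    · refine ⟨hVC.2 t ht v hv.1, ?_⟩
      change φ s (φ t v) ∈ V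
      rw [hφ (hcomm s hs t ht)]
      exact hVC.2 t ht _ hv.2
  have hVS₀ : ∀ s ∈ S₀, ∀ v ∈ V, φ s v = 0 := by
    intro s hs v hv
    -- The kernel of `s` is a member of `C`: it contains the ranges of `T₀` by `h₀` and is
    -- `T`-invariant by commutation.
    refine hV (LinearMap.ker (φ s).toLinearMap) ⟨fun t ht v => ?_, fun t ht v hv => ?_⟩ hv
    · change φ s (φ t v) = 0
      rw [← mul_apply_eq_comp, ← map_mul, h₀ s hs t ht]
      simp
    · change φ s (φ t v) = 0
      rw [hφ (hspan hcomm s (hS₀ hs) t ht), show φ s v = 0 from hv, map_zero]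
  have hinv : ∀ A : Matrix P P ℂ, (∀ v ∈ V, φ A v ∈ V) → (∀ v ∈ V, φ Aᴴ v ∈ V) →
      V.starProjection * φ A = φ A * V.starProjection := by
    intro A h1 h2
    ext1 v
    refine (Submodule.eq_starProjection_of_mem_orthogonal (h1 _ (V.starProjection_apply_mem v))
      ?_)
    change φ A v - φ A (V.starProjection v) ∈ Vᗮ
    rw [← map_sub]
    intro w hw
    have h3 := V.sub_starProjection_mem_orthogonal v _ (h2 w hw)
    have h4 : φ Aᴴ = ContinuousLinearMap.adjoint (φ A) := map_star φ A
    rwa [h4, ContinuousLinearMap.adjoint_inner_left] at h3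
  set Q := φ.symm V.starProjection
  have hQ : φ Q = V.starProjection := φ.apply_symm_apply _
  have hc : ∀ A : Matrix P P ℂ, (∀ v ∈ V, φ A v ∈ V) → (∀ v ∈ V, φ Aᴴ v ∈ V) → Commute Q A := by
    intro A h1 h2
    apply (EquivLike.injective φ)
    rw [map_mul, map_mul, hQ, hinv A h1 h2]
  have hQT : ∀ t ∈ T, Commute Q t := fun t ht => hc t (hVC.2 t ht) (hVC.2 _ (hT t ht))
  refine ⟨Q, ?_, ?_, fun s hs => hc s (hVS s hs) (hVS _ (hS s hs)), hQT, ?_, ?_⟩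
  · apply (EquivLike.injective φ)
    rw [← Matrix.star_eq_conjTranspose, map_star, hQ]
    exact isSelfAdjoint_starProjection V
  · apply (EquivLike.injective φ)
    rw [map_mul, hQ]
    exact V.isIdempotentElem_starProjection
  · intro s hs
    apply (EquivLike.injective φ)
    rw [map_mul, hQ, map_zero]
    ext1 v
    exact hVS₀ s hs _ (V.starProjection_apply_mem v)
  · intro t ht
    have h1 : Q * t = t := by
      apply (EquivLike.injective φ)
      rw [map_mul, hQ]
      ext1 v
      exact Submodule.starProjection_eq_self_iff.2 (hVC.1 t ht v)
    have h2 : Commute t Q := hspan (T := {Q}) (fun t ht s hs => by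
      rw [Set.mem_singleton_iff.1 hs]; exact (hQT t ht).symm) t (hT₀ ht) Q rfl
    rw [mul_sub, mul_one, h2.eq, h1, sub_self]

/-! ### The structure of pure processes -/

section Pure

variable {P AI AO BI BO F : Type} [Fintype P] [DecidableEq P] [Fintype AI] [DecidableEq AI]
  [Fintype AO] [DecidableEq AO] [Fintype BI] [DecidableEq BI] [Fintype BO] [DecidableEq BO]
  [Fintype F] [DecidableEq F]

/-- A pure process is the Choi operator of a unitary from the past and the outputs of the parties
to the future and the inputs of the parties. -/
theorem IsPure.exists_unitary {W : ProcOp P AI AO BI BO F} (hW : IsPure W) :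
    ∃ U : Matrix (F × AI × BI) (P × AO × BO) ℂ, IsUnitary U ∧
      ∀ x i j f x' i' j' f',
        W (x, (i, j, f)) (x', (i', j', f')) = U (f, i, j) x * star (U (f', i', j') x') := by
  -- Swapping each slot with its ancilla exposes the slots as open systems, so the resulting unitary
  -- carries `W` itself.
  obtain ⟨U, hU, h⟩ := hW.2 AO AI BO BI (swapOp AI AO) (swapOp BI BO) (isUnitary_swapOp _ _)
    (isUnitary_swapOp _ _)
  refine ⟨U, hU, fun x i j f x' i' j' f' => ?_⟩
  obtain ⟨p, a, b⟩ := x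
  obtain ⟨p', a', b'⟩ := x'
  have h1 := congrFun (congrFun h ((p, a, b), (f, i, j))) ((p', a', b'), (f', i', j'))
  simp only [dketbra, Matrix.vecMulVec_apply, choiVec, Pi.star_apply] at h1
  rw [h1]
  simp [plugTwo, relabel, linkProduct, swapOp, Matrix.vecMulVec_apply, choiVec,
    Fintype.sum_prod_type, ite_and, apply_ite (starRingEnd ℂ)]

omit [DecidableEq AO] [DecidableEq BO] [DecidableEq F] in
theorem IsProcess.sum_eq {W : ProcOp P AI AO BI BO F} (hW : IsProcess W) (p p' : P)
    (EA : Matrix (AI × AO) (AI × AO) ℂ) (EB : Matrix (BI × BO) (BI × BO) ℂ)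
    (hA : IsChannelChoi EA) (hB : IsChannelChoi EB) :
    ∑ y, ∑ y', ∑ z, ∑ z', (∑ f, W ((p, y.2, z.2), (y.1, z.1, f)) ((p', y'.2, z'.2), (y'.1, z'.1, f)))
      * EA y y' * EB z z' = if p = p' then 1 else 0 := by
  have hE : ∀ {I O : Type} [Fintype I] [DecidableEq I] [Fintype O] {C : Matrix (I × O) (I × O) ℂ},
      IsChannelChoi C → IsChannelChoi
        (C.submatrix (fun x : (I × Unit) × (O × Unit) => (x.1.1, x.2.1))
          (fun x : (I × Unit) × (O × Unit) => (x.1.1, x.2.1))) := by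
    intro I O _ _ _ C hC
    obtain ⟨h1, h2⟩ := isChannelChoi_iff.1 hC
    refine isChannelChoi_iff.2 ⟨h1.submatrix _, fun i i' => ?_⟩
    simpa [Fintype.sum_prod_type, Prod.ext_iff] using h2 i.1 i'.1
  have h := (isChannelChoi_iff.1 (hW Unit Unit Unit Unit _ _ (hE hA) (hE hB))).2
    (p, (), ()) (p', (), ())
  simp only [plugTwo, relabel, linkProduct, Matrix.submatrix_apply, Matrix.of_apply,
    Matrix.kroneckerMap_apply, Prod.mk.injEq, and_true] at h
  rw [← h]
  conv_rhs => rw [Fintype.sum_prod_type]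
  simp only [Fintype.sum_prod_type (α₂ := Unit),
    Finset.univ_unique, Finset.sum_singleton]
  simp only [Fintype.sum_prod_type (α₁ := AI × AO), Finset.sum_mul, mul_assoc]
  symm
  exact Finset.sum_comm.trans (Finset.sum_congr rfl fun y _ => Finset.sum_comm.trans
    ((Finset.sum_congr rfl fun z _ => Finset.sum_comm.trans
      (Finset.sum_congr rfl fun y' _ => Finset.sum_comm)).trans Finset.sum_comm))

/-- The marginal of `W` on the inputs of the parties factorizes into two commuting families of
operators on the past: `α`, which describes the input of `A` and depends on the output of `B`, and
`β`, which describes the input of `B` and depends on the output of `A`. At most one of the two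
dependencies is present. -/
structure IsFactorized (W : ProcOp P AI AO BI BO F) (α : AI → BO → AI → BO → Matrix P P ℂ)
    (β : BI → AO → BI → AO → Matrix P P ℂ) : Prop where
  marginal : ∀ p a b i j p' a' b' i' j',
    ∑ f, W ((p, a, b), (i, j, f)) ((p', a', b'), (i', j', f)) = (α i' b' i b * β j' a' j a) p' p
  commute : ∀ i' b' i b j' a' j a, Commute (α i' b' i b) (β j' a' j a)
  left_adjoint : ∀ i' b' i b, (α i' b' i b)ᴴ = α i b i' b'
  right_adjoint : ∀ j' a' j a, (β j' a' j a)ᴴ = β j a j' a'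
  left_sum : ∀ b' b, ∑ i, α i b' i b = if b = b' then 1 else 0
  right_sum : ∀ a' a, ∑ j, β j a' j a = if a = a' then 1 else 0
  mul_eq_zero : ∀ (Y : Matrix BO BO ℂ) (X : Matrix AO AO ℂ), Y.trace = 0 → X.trace = 0 →
    ∀ i' i j' j, (∑ b, ∑ b', Y b b' • α i' b' i b) * (∑ a, ∑ a', X a a' • β j' a' j a) = 0

omit [Fintype P] [DecidableEq P] [Fintype AO] [DecidableEq AO] [Fintype BO] [DecidableEq BO] in
theorem conjugate_apply (U : Matrix (F × AI × BI) (P × AO × BO) ℂ) (i' i : AI) (j' j : BI)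
    (x' x : P × AO × BO) :
    (Uᴴ * ((1 : Matrix F F ℂ) ⊗ₖ (Matrix.single i' i (1 : ℂ) ⊗ₖ Matrix.single j' j (1 : ℂ))) * U)
      x' x = ∑ f, star (U (f, i', j') x') * U (f, i, j) x := by
  simp only [Matrix.mul_apply, Matrix.conjTranspose_apply, Matrix.kroneckerMap_apply,
    Fintype.sum_prod_type, Matrix.one_apply, Matrix.single_apply, ite_and, ite_mul, mul_ite,
    mul_one, zero_mul, mul_zero, Finset.sum_ite_eq, Finset.sum_ite_eq', Finset.mem_univ,
    if_true, Finset.sum_ite_irrel, Finset.sum_const_zero]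

theorem sum_single_eq_one {I : Type} [Fintype I] [DecidableEq I] :
    ∑ i : I, Matrix.single i i (1 : ℂ) = 1 := by
  ext; simp [Matrix.sum_apply, Matrix.single_apply, Matrix.one_apply, ite_and]

/-- The unitary makes `G` multiplicative, so the images of operators on `AI` and on `BI` commute and
multiply to the marginal of `W`; `α` and `β` are their blocks. -/
theorem IsPure.exists_isFactorized [Nonempty AO] [Nonempty BO] {W : ProcOp P AI AO BI BO F}
    (hW : IsPure W) : ∃ α β, IsFactorized W α β := by
  obtain ⟨a₀⟩ := ‹Nonempty AO›
  obtain ⟨b₀⟩ := ‹Nonempty BO›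
  have : Nonempty AO := ⟨a₀⟩
  have : Nonempty BO := ⟨b₀⟩
  obtain ⟨U, ⟨hU, hU'⟩, hWU⟩ := hW.exists_unitary
  let T : P → P → AI × AO → AI × AO → BI × BO → BI × BO → ℂ := fun p p' y y' z z' =>
    ∑ f, W ((p, y.2, z.2), (y.1, z.1, f)) ((p', y'.2, z'.2), (y'.1, z'.1, f))
  have hT : ∀ p p' EA EB, IsChannelChoi EA → IsChannelChoi EB →
      ∑ y, ∑ y', ∑ z, ∑ z', T p p' y y' z z' * EA y y' * EB z z' = if p = p' then 1 else 0 :=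
    fun p p' EA EB hA hB => hW.1.sum_eq p p' EA EB hA hB
  have hT' : ∀ p p' EB EA, IsChannelChoi EB → IsChannelChoi EA →
      ∑ z, ∑ z', ∑ y, ∑ y', T p p' y y' z z' * EB z z' * EA y y' = if p = p' then 1 else 0 := by
    intro p p' EB EA hB hA
    rw [← hT p p' EA EB hA hB]
    simp only [mul_right_comm _ (EB _ _) (EA _ _)]
    calc _ = ∑ z, ∑ y, ∑ z', ∑ y', T p p' y y' z z' * EA y y' * EB z z' :=
          Finset.sum_congr rfl fun z _ => Finset.sum_comm
      _ = ∑ y, ∑ z, ∑ z', ∑ y', T p p' y y' z z' * EA y y' * EB z z' := Finset.sum_comm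
      _ = ∑ y, ∑ z, ∑ y', ∑ z', T p p' y y' z z' * EA y y' * EB z z' :=
          Finset.sum_congr rfl fun y _ => Finset.sum_congr rfl fun z _ => Finset.sum_comm
      _ = _ := Finset.sum_congr rfl fun y _ => Finset.sum_comm
  let G : Matrix AI AI ℂ → Matrix BI BI ℂ → Matrix (P × AO × BO) (P × AO × BO) ℂ :=
    fun N M => Uᴴ * ((1 : Matrix F F ℂ) ⊗ₖ (N ⊗ₖ M)) * U
  have hG : ∀ p a b i j p' a' b' i' j',
      G (Matrix.single i' i 1) (Matrix.single j' j 1) (p', a', b') (p, a, b) =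
        T p p' (i, a) (i', a') (j, b) (j', b') := by
    intros
    simp only [G, T, conjugate_apply, hWU, mul_comm]
  have hGmul : ∀ N M N' M', G N M * G N' M' = G (N * N') (M * M') := by
    intro N M N' M'
    calc _ = Uᴴ * ((1 : Matrix F F ℂ) ⊗ₖ (N ⊗ₖ M)) * (U * Uᴴ) *
          ((1 : Matrix F F ℂ) ⊗ₖ (N' ⊗ₖ M')) * U := by simp only [G, Matrix.mul_assoc]
      _ = _ := by
        rw [hU', Matrix.mul_one, Matrix.mul_assoc Uᴴ, ← Matrix.mul_kronecker_mul,
          ← Matrix.mul_kronecker_mul, Matrix.one_mul]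
  have hGstar : ∀ N M, (G N M)ᴴ = G Nᴴ Mᴴ := by
    intro N M
    simp only [G, Matrix.conjTranspose_mul, Matrix.conjTranspose_kronecker,
      Matrix.conjTranspose_conjTranspose, Matrix.conjTranspose_one, Matrix.mul_assoc]
  have hGone : G 1 1 = 1 := by simp [G, hU]
  have hGsumr : ∀ N, ∑ j, G N (Matrix.single j j 1) = G N 1 := by
    intro N
    simp only [G]
    rw [← Matrix.sum_mul, ← Matrix.mul_sum]
    congr 2
    ext
    simp only [Matrix.sum_apply, Matrix.kroneckerMap_apply, ← Finset.mul_sum]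
    rw [← Matrix.sum_apply, sum_single_eq_one]
  have hGsuml : ∀ M, ∑ i, G (Matrix.single i i 1) M = G 1 M := by
    intro M
    simp only [G]
    rw [← Matrix.sum_mul, ← Matrix.mul_sum]
    congr 2
    ext
    simp only [Matrix.sum_apply, Matrix.kroneckerMap_apply, ← Finset.mul_sum, ← Finset.sum_mul]
    rw [← Matrix.sum_apply, sum_single_eq_one]
  let A : AI → AI → Matrix (P × AO × BO) (P × AO × BO) ℂ := fun i' i => G (Matrix.single i' i 1) 1
  let B : BI → BI → Matrix (P × AO × BO) (P × AO × BO) ℂ := fun j' j => G 1 (Matrix.single j' j 1)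
  let α : AI → BO → AI → BO → Matrix P P ℂ := fun i' b' i b =>
    Matrix.of fun p' p => A i' i (p', a₀, b') (p, a₀, b)
  let β : BI → AO → BI → AO → Matrix P P ℂ := fun j' a' j a =>
    Matrix.of fun p' p => B j' j (p', a', b₀) (p, a, b₀)
  have hA : ∀ i' i p' a' b' p a b,
      A i' i (p', a', b') (p, a, b) = if a = a' then α i' b' i b p' p else 0 := by
    intro i' i p' a' b' p a b
    have h := sum_input_eq_ite (hT p p') i i' a₀ a a' b b'
    simp only [← hG, ← Matrix.sum_apply, hGsumr] at h
    exact h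
  have hB : ∀ j' j p' a' b' p a b,
      B j' j (p', a', b') (p, a, b) = if b = b' then β j' a' j a p' p else 0 := by
    intro j' j p' a' b' p a b
    have h := sum_input_eq_ite (T := fun z z' y y' => T p p' y y' z z') (hT' p p') j j' b₀ b b' a a'
    simp only [← hG, ← Matrix.sum_apply, hGsuml] at h
    exact h
  -- As `A` is diagonal in `AO` and `B` in `BO`, the only intermediate indices that survive are `a'`
  -- and `b`, leaving a product on the past.
  have hAB : ∀ i' b' i b j' a' j a p' p, (α i' b' i b * β j' a' j a) p' p =
      G (Matrix.single i' i 1) (Matrix.single j' j 1) (p', a', b') (p, a, b) := by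
    intro i' b' i b j' a' j a p' p
    have : G (Matrix.single i' i 1) (Matrix.single j' j 1) = A i' i * B j' j := by
      simp only [A, B, hGmul, Matrix.mul_one, Matrix.one_mul]
    rw [this]
    simp [Matrix.mul_apply, Fintype.sum_prod_type, hA, hB]
  have hBA : ∀ i' b' i b j' a' j a p' p, (β j' a' j a * α i' b' i b) p' p =
      G (Matrix.single i' i 1) (Matrix.single j' j 1) (p', a', b') (p, a, b) := by
    intro i' b' i b j' a' j a p' p
    have : G (Matrix.single i' i 1) (Matrix.single j' j 1) = B j' j * A i' i := by
      simp only [A, B, hGmul, Matrix.mul_one, Matrix.one_mul]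
    rw [this]
    simp [Matrix.mul_apply, Fintype.sum_prod_type, hA, hB]
  have hloop : ∀ (Y : Matrix BO BO ℂ) (X : Matrix AO AO ℂ), Y.trace = 0 → X.trace = 0 →
      ∀ i' i j' j,
        (∑ b, ∑ b', Y b b' • α i' b' i b) * (∑ a, ∑ a', X a a' • β j' a' j a) = 0 := by
    intro Y X hY hX i' i j' j
    ext p' p
    have h := pairing_traceless_both (hT p p') i i' j j' hX hY
    rw [Matrix.zero_apply, ← h]
    simp only [Matrix.mul_sum, Matrix.smul_mul, Matrix.mul_smul, Matrix.sum_apply,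
      Matrix.smul_apply, hAB, hG, smul_eq_mul, Finset.sum_mul]
    simp only [mul_comm, mul_left_comm]
  refine ⟨α, β, ?_, ?_, ?_, ?_, ?_, ?_, hloop⟩
  · intros
    rw [hAB, hG]
  · intros
    ext p' p
    rw [hAB, hBA]
  · intro i' b' i b
    ext p' p
    have := congrFun (congrFun (hGstar (Matrix.single i' i 1) 1) (p', a₀, b)) (p, a₀, b')
    simpa [Matrix.conjTranspose_single, α, A] using this
  · intro j' a' j a
    ext p' p
    have := congrFun (congrFun (hGstar 1 (Matrix.single j' j 1)) (p', a, b₀)) (p, a', b₀)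
    simpa [Matrix.conjTranspose_single, β, B] using this
  · intro b' b
    ext p' p
    have := congrFun (congrFun ((hGsuml 1).trans hGone) (p', a₀, b')) (p, a₀, b)
    rw [Matrix.sum_apply] at this ⊢
    simp only [α, A, Matrix.of_apply, this]
    split_ifs with h
    · simp [Matrix.one_apply, h]
    · simp [Ne.symm h]
  · intro a' a
    ext p' p
    have := congrFun (congrFun ((hGsumr 1).trans hGone) (p', a', b₀)) (p, a, b₀)
    rw [Matrix.sum_apply] at this ⊢
    simp only [β, B, Matrix.of_apply, this]
    split_ifs with h
    · simp [Matrix.one_apply, h]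
    · simp [Ne.symm h]

end Pure

/-! ### Operations on the global past -/

section Precompose

variable {P Q Q' AI AO BI BO F : Type}

theorem precompose_apply [Fintype Q] (K : Matrix Q P ℂ) (W : ProcOp Q AI AO BI BO F)
    (p : P) (a : AO) (b : BO) (u : AI × BI × F) (p' : P) (a' : AO) (b' : BO) (u' : AI × BI × F) :
    precompose K W ((p, a, b), u) ((p', a', b'), u') =
      ∑ q, ∑ q', K q p * star (K q' p') * W ((q, a, b), u) ((q', a', b'), u') := rfl

theorem precompose_apply_of_eq [Fintype Q] {K : Matrix Q P ℂ} {W : ProcOp Q AI AO BI BO F}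
    {a : AO} {b : BO} {u : AI × BI × F} {a' : AO} {b' : BO} {u' : AI × BI × F} {G : Matrix Q Q ℂ}
    (h : ∀ q q', W ((q, a, b), u) ((q', a', b'), u') = G q' q) (p p' : P) :
    precompose K W ((p, a, b), u) ((p', a', b'), u') = (Kᴴ * G * K) p' p := by
  simp only [precompose_apply, h, Matrix.mul_apply, Matrix.conjTranspose_apply, Finset.sum_mul]
  exact Finset.sum_congr rfl fun q _ => Finset.sum_congr rfl fun q' _ => by ring

theorem precompose_posSemidef [Fintype P] [Fintype Q] [Fintype AI] [Fintype AO] [Fintype BI]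
    [Fintype BO] [Fintype F] (K : Matrix Q P ℂ) {W : ProcOp Q AI AO BI BO F}
    (hW : W.PosSemidef) : (precompose K W).PosSemidef :=
  (linkProduct_posSemidef (Matrix.posSemidef_vecMulVec_self_star _) (hW.submatrix _)).submatrix _

theorem precompose_add [Fintype Q] (K : Matrix Q P ℂ) (W W' : ProcOp Q AI AO BI BO F) :
    precompose K (W + W') = precompose K W + precompose K W' := by
  ext ⟨⟨p, a, b⟩, u⟩ ⟨⟨p', a', b'⟩, u'⟩
  simp only [precompose_apply, Matrix.add_apply, mul_add, Finset.sum_add_distrib]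

theorem precompose_precompose [Fintype Q] [Fintype Q'] (K : Matrix Q P ℂ) (R : Matrix Q' Q ℂ)
    (W : ProcOp Q' AI AO BI BO F) :
    precompose K (precompose R W) = precompose (R * K) W := by
  ext ⟨⟨p, a, b⟩, u⟩ ⟨⟨p', a', b'⟩, u'⟩
  rw [precompose_apply_of_eq fun q q' => precompose_apply_of_eq
    (G := Matrix.of fun r' r => W ((r, a, b), u) ((r', a', b'), u')) (fun _ _ => rfl) q q',
    precompose_apply_of_eq
    (G := Matrix.of fun r' r => W ((r, a, b), u) ((r', a', b'), u')) fun _ _ => rfl]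
  simp only [Matrix.conjTranspose_mul, Matrix.mul_assoc]

theorem swapParties_precompose [Fintype Q] (K : Matrix Q P ℂ) (W : ProcOp Q AI AO BI BO F) :
    swapParties (precompose K W) = precompose K (swapParties W) := rfl

theorem precompose_depolarizingProcess [Fintype Q] [DecidableEq AI] [Fintype AI] [DecidableEq AO]
    [DecidableEq BI] [Fintype BI] [DecidableEq BO] {K : Matrix Q P ℂ} {t : Matrix Q Q ℂ}
    (h : t * K = 0) : precompose K (depolarizingProcess Q AI AO BI BO t) = 0 := by
  ext ⟨⟨p, a, b⟩, u⟩ ⟨⟨p', a', b'⟩, u'⟩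
  rw [precompose_apply_of_eq (G := ((Fintype.card AI : ℂ)⁻¹ * (Fintype.card BI : ℂ)⁻¹ *
    (1 : Matrix (AO × BO) (AO × BO) ℂ) (a, b) (a', b') *
    (1 : Matrix (AI × BI × Unit) (AI × BI × Unit) ℂ) u u') • t)
    (fun q q' => by simp [depolarizingProcess]; ring)]
  simp [Matrix.mul_assoc, h]

/-- Discard the global future. -/
def traceFuture [Fintype F] (W : ProcOp P AI AO BI BO F) : ProcOp P AI AO BI BO Unit :=
  ∑ f, W.submatrix (fun x => (x.1, (x.2.1, x.2.2.1, f))) (fun x => (x.1, (x.2.1, x.2.2.1, f)))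

theorem traceFuture_apply [Fintype F] (W : ProcOp P AI AO BI BO F) (x i j u x' i' j' u') :
    traceFuture W (x, (i, j, u)) (x', (i', j', u')) = ∑ f, W (x, (i, j, f)) (x', (i', j', f)) := by
  simp [traceFuture, Matrix.sum_apply]

theorem traceFuture_posSemidef [Fintype F] {W : ProcOp P AI AO BI BO F} (hW : W.PosSemidef) :
    (traceFuture W).PosSemidef :=
  Matrix.posSemidef_sum _ fun _ _ => hW.submatrix _

/-- Inserting `ψ` is precomposition with the map `p ↦ p ⊗ ψ`, an isometry when `ψ` is a unit vector.
-/
theorem insertAndTrace_eq_precompose {Ps Fs : Type} [Fintype P] [DecidableEq P] [Fintype Ps]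
    [Fintype Fs] [DecidableEq Fs] (W : ProcOp (P × Ps) AI AO BI BO (Unit × Fs)) (ψ : Ps → ℂ) :
    insertAndTrace W ψ =
      precompose (Matrix.of fun s p => if s.1 = p then ψ s.2 else 0) (traceFuture W) := by
  ext ⟨⟨p, a, b⟩, i, j, u⟩ ⟨⟨p', a', b'⟩, i', j', u'⟩
  rw [precompose_apply]
  simp only [insertAndTrace, relabel, linkProduct, Matrix.submatrix_apply, Matrix.of_apply,
    Matrix.kroneckerMap_apply, Matrix.vecMulVec_apply, Pi.star_apply, Matrix.one_apply,
    traceFuture_apply, Fintype.sum_prod_type, apply_ite star, star_zero, ite_mul, mul_ite, mul_one,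
    zero_mul, mul_zero, Finset.sum_ite_irrel, Finset.sum_const_zero, Finset.sum_ite_eq,
    Finset.sum_ite_eq', Finset.mem_univ, if_true, Finset.univ_unique, Finset.sum_singleton,
    PUnit.default_eq_unit, Finset.mul_sum]
  refine Finset.sum_congr rfl fun s _ => ?_
  rw [Finset.sum_comm]
  refine Finset.sum_congr rfl fun s' _ => Finset.sum_congr rfl fun f _ => by ring

end Precompose

/-! ### Separation of the causal orders -/

section Separation

variable {P Q AI AO BI BO F : Type} [Fintype P] [DecidableEq P] [Fintype Q] [DecidableEq Q]
  [Fintype AI] [DecidableEq AI] [Fintype AO] [DecidableEq AO] [Fintype BI] [DecidableEq BI]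
  [Fintype BO] [DecidableEq BO] [Fintype F] [DecidableEq F]

omit [DecidableEq AI] [DecidableEq BI] [DecidableEq F] in
theorem IsFactorized.discardFuture {W : ProcOp P AI AO BI BO F} {α β} (h : IsFactorized W α β) :
    IsFactorized (traceFuture W) α β where
  __ := h
  marginal := by simpa [traceFuture_apply] using h.marginal

omit [DecidableEq AI] [DecidableEq BI] [DecidableEq F] in
theorem IsFactorized.swap {W : ProcOp P AI AO BI BO F} {α β} (h : IsFactorized W α β) :
    IsFactorized (swapParties W) β α where
  marginal p b a j i p' b' a' j' i' := by
    rw [← (h.commute _ _ _ _ _ _ _ _).eq, ← h.marginal]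
    rfl
  commute _ _ _ _ _ _ _ _ := (h.commute _ _ _ _ _ _ _ _).symm
  left_adjoint := h.right_adjoint
  right_adjoint := h.left_adjoint
  left_sum := h.right_sum
  right_sum := h.left_sum
  mul_eq_zero X Y hX hY j' j i' i := by
    rw [← h.mul_eq_zero Y X hY hX i' i j' j]
    refine (Commute.sum_left _ _ _ fun a _ => Commute.sum_left _ _ _ fun a' _ =>
      Commute.sum_right _ _ _ fun b _ => Commute.sum_right _ _ _ fun b' _ => ?_).eq
    exact (((h.commute _ _ _ _ _ _ _ _).symm).smul_left _).smul_right _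

theorem IsPure.posSemidef {W : ProcOp P AI AO BI BO F} (hW : IsPure W) : W.PosSemidef := by
  obtain ⟨U, -, h⟩ := hW.exists_unitary
  convert Matrix.posSemidef_vecMulVec_self_star
    (fun x : (P × AO × BO) × (AI × BI × F) => U (x.2.2.2, x.2.1, x.2.2.1) x.1)
  ext x x'
  exact h _ _ _ _ _ _ _ _

variable {M : ProcOp Q AI AO BI BO Unit} {α : AI → BO → AI → BO → Matrix Q Q ℂ}
    {β : BI → AO → BI → AO → Matrix Q Q ℂ}

omit [Fintype P] [DecidableEq P] [DecidableEq AI] [DecidableEq BI] in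
theorem IsFactorized.precompose_apply (h : IsFactorized M α β) (R : Matrix Q P ℂ)
    (p a b i j u p' a' b' i' j' u') :
    precompose R M ((p, a, b), (i, j, u)) ((p', a', b'), (i', j', u')) =
      (Rᴴ * (α i' b' i b * β j' a' j a) * R) p' p :=
  precompose_apply_of_eq (fun q q' => by simpa using h.marginal q a b i j q' a' b' i' j') p p'

omit [DecidableEq P] [DecidableEq AI] [DecidableEq BI] in
-- Moving `α` next to `R` by commutation removes the dependence on the output of `B`; the sum rules
-- for `β` and then `α` give the marginals.
theorem IsFactorized.isOrdered_precompose (h : IsFactorized M α β) (hM : M.PosSemidef)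
    {R : Matrix Q P ℂ} (b₀ : BO)
    (hR : ∀ i' b' i b, α i' b' i b * R = if b = b' then α i' b₀ i b₀ * R else 0) :
    IsOrdered (precompose R M) (Rᴴ * R) := by
  refine ⟨precompose_posSemidef R hM,
    fun p a i j p' a' i' j' => (Rᴴ * (β j' a' j a * (α i' b₀ i b₀ * R))) p' p,
    fun p i p' i' => (Rᴴ * (α i' b₀ i b₀ * R)) p' p, ?_, ?_, ?_⟩
  · intro p a b i j p' a' b' i' j'
    rw [h.precompose_apply, (h.commute _ _ _ _ _ _ _ _).eq, Matrix.mul_assoc, Matrix.mul_assoc, hR]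
    split_ifs <;> simp
  · intro p a i p' a' i'
    rw [← Matrix.sum_apply, ← Matrix.mul_sum, ← Matrix.sum_mul, h.right_sum]
    split_ifs <;> simp
  · intro p p'
    rw [← Matrix.sum_apply, ← Matrix.mul_sum, ← Matrix.sum_mul, h.left_sum]
    simp

theorem IsFactorized.exists_isCombAB [Nonempty AI] [Nonempty BI] [Nonempty BO]
    (h : IsFactorized M α β) (hM : M.PosSemidef) {V : Matrix Q P ℂ}
    (hV : ∀ Y : Matrix BO BO ℂ, Y.trace = 0 → ∀ i' i,
      (∑ b, ∑ b', Y b b' • α i' b' i b) * V = 0) :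
    ∃ (K : Matrix P P ℂ) (W : ProcOp P AI AO BI BO Unit),
      Kᴴ * K = Vᴴ * V ∧ IsCombAB W ∧ precompose K W = precompose V M := by
  obtain ⟨b₀⟩ := ‹Nonempty BO›
  obtain ⟨K, Z, hVK, hK, hpos, hzero⟩ := exists_partialIsometry_mul V
  have hαV : ∀ i' b' i b, α i' b' i b * V = if b = b' then α i' b₀ i b₀ * V else 0 := by
    intro i' b' i b
    ext q p
    have := eq_ite_of_pairing_traceless (g := fun b b' => (α i' b' i b * V) q p)
      (fun Y hY => by
        have := congrFun (congrFun (hV Y hY i' i) q) p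
        simpa [Matrix.sum_mul, Matrix.sum_apply, mul_comm] using this) b₀ b b'
    rw [this]
    split_ifs <;> rfl
  have hord := h.isOrdered_precompose hM (R := V * Z) b₀ fun i' b' i b => by
    rw [← Matrix.mul_assoc, hαV, ← Matrix.mul_assoc]
    split_ifs <;> simp
  -- The partial isometry `V * Z` leaves the deficit `1 - (V * Z)ᴴ * (V * Z)`. The depolarizing
  -- process fills it, unseen after `K`.
  refine ⟨K, precompose (V * Z) M + depolarizingProcess P AI AO BI BO (1 - (V * Z)ᴴ * (V * Z)),
    hK, ?_, ?_⟩
  · refine IsOrdered.isCombAB ?_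
    have := hord.add (isOrdered_depolarizingProcess hpos)
    rwa [add_sub_cancel] at this
  · rw [precompose_add, precompose_precompose, hVK, precompose_depolarizingProcess hzero, add_zero]

/-- `E` comes from `exists_projection` with the signalling parts as `S₀` and `T₀`. The second order
is the first applied to `h.swap`. -/
theorem IsFactorized.exists_separation [Nonempty AI] [Nonempty AO] [Nonempty BI] [Nonempty BO]
    (h : IsFactorized M α β) (hM : M.PosSemidef) {V : Matrix Q P ℂ} (hV : Vᴴ * V = 1) :
    IsCausallySeparableGivenPast (precompose V M) := by
  obtain ⟨E, hE, hEE, hEα, hEβ, hαE, hβE⟩ := exists_projection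
    (S := {x | ∃ i' b' i b, x = α i' b' i b}) (T := {x | ∃ j' a' j a, x = β j' a' j a})
    (S₀ := {x | ∃ Y : Matrix BO BO ℂ, Y.trace = 0 ∧ ∃ i' i, x = ∑ b, ∑ b', Y b b' • α i' b' i b})
    (T₀ := {x | ∃ X : Matrix AO AO ℂ, X.trace = 0 ∧ ∃ j' j, x = ∑ a, ∑ a', X a a' • β j' a' j a})
    (by rintro _ ⟨i', b', i, b, rfl⟩ _ ⟨j', a', j, a, rfl⟩; exact h.commute _ _ _ _ _ _ _ _)
    (by rintro _ ⟨i', b', i, b, rfl⟩; exact ⟨_, _, _, _, h.left_adjoint _ _ _ _⟩)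
    (by rintro _ ⟨j', a', j, a, rfl⟩; exact ⟨_, _, _, _, h.right_adjoint _ _ _ _⟩)
    (by
      rintro _ ⟨Y, -, i', i, rfl⟩
      exact Submodule.sum_mem _ fun b _ => Submodule.sum_mem _ fun b' _ =>
        Submodule.smul_mem _ _ (Submodule.subset_span ⟨_, _, _, _, rfl⟩))
    (by
      rintro _ ⟨X, -, j', j, rfl⟩
      exact Submodule.sum_mem _ fun a _ => Submodule.sum_mem _ fun a' _ =>
        Submodule.smul_mem _ _ (Submodule.subset_span ⟨_, _, _, _, rfl⟩))
    (by
      rintro _ ⟨Y, hY, i', i, rfl⟩ _ ⟨X, hX, j', j, rfl⟩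
      exact h.mul_eq_zero Y X hY hX _ _ _ _)
  have hE' : (1 - E)ᴴ = 1 - E := by rw [Matrix.conjTranspose_sub, hE, Matrix.conjTranspose_one]
  have hEE' : (1 - E) * (1 - E) = 1 - E := by
    rw [mul_sub, mul_one, sub_mul, one_mul, hEE, sub_self, sub_zero]
  obtain ⟨K₁, W₁, hK₁, hW₁, h₁⟩ := h.exists_isCombAB hM (V := E * V) fun Y hY i' i => by
    rw [← Matrix.mul_assoc, hαE _ ⟨Y, hY, i', i, rfl⟩, Matrix.zero_mul]
  obtain ⟨K₂, W₂, hK₂, hW₂, h₂⟩ := h.swap.exists_isCombAB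
    (hM.submatrix _) (V := (1 - E) * V) fun X hX j' j => by
    rw [← Matrix.mul_assoc, hβE _ ⟨X, hX, j', j, rfl⟩, Matrix.zero_mul]
  have hgram : ∀ D : Matrix Q Q ℂ, Dᴴ = D → D * D = D → (D * V)ᴴ * (D * V) = Vᴴ * D * V := by
    intro D hD hDD
    rw [Matrix.conjTranspose_mul, hD, Matrix.mul_assoc, ← Matrix.mul_assoc D, hDD,
      Matrix.mul_assoc]
  refine ⟨K₁, K₂, W₁, swapParties W₂, ?_, hW₁, hW₂, ?_⟩
  · rw [hK₁, hK₂, hgram E hE hEE, hgram _ hE' hEE', ← Matrix.add_mul, ← Matrix.mul_add,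
      add_sub_cancel, Matrix.mul_one, hV]
  · rw [h₁, ← swapParties_precompose, h₂, swapParties_precompose]
    change _ = _ + precompose ((1 - E) * V) M
    ext ⟨⟨p, a, b⟩, i, j, u⟩ ⟨⟨p', a', b'⟩, i', j', u'⟩
    rw [Matrix.add_apply, h.precompose_apply, h.precompose_apply, h.precompose_apply,
      ← Matrix.add_apply]
    have hG : Commute E (α i' b' i b * β j' a' j a) :=
      (hEα _ ⟨_, _, _, _, rfl⟩).mul_right (hEβ _ ⟨_, _, _, _, rfl⟩)
    have hG' : Commute (1 - E) (α i' b' i b * β j' a' j a) := (Commute.one_left _).sub_left hG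
    -- A projection commuting with the marginal is needed on one side only, so the two branches add
    -- up linearly to `precompose V M`.
    have key : ∀ D : Matrix Q Q ℂ, Dᴴ = D → D * D = D → Commute D (α i' b' i b * β j' a' j a) →
        (D * V)ᴴ * (α i' b' i b * β j' a' j a) * (D * V) =
          Vᴴ * (α i' b' i b * β j' a' j a) * (D * V) := by
      intro D hD hDD hDG
      rw [Matrix.conjTranspose_mul, hD, Matrix.mul_assoc Vᴴ D, hDG.eq]
      simp only [Matrix.mul_assoc]
      rw [← Matrix.mul_assoc D D, hDD]
    rw [key E hE hEE hG, key _ hE' hEE' hG', ← Matrix.mul_add, ← Matrix.add_mul, add_sub_cancel,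
      Matrix.one_mul]

omit [DecidableEq F] in
-- On a one-dimensional past the Kraus operators are numbers, and the weights are their squared
-- moduli.
theorem IsCausallySeparableGivenPast.isCausallySeparable {W : ProcOp P AI AO BI BO F}
    (hW : IsCausallySeparableGivenPast W) (hP : Fintype.card P = 1) : IsCausallySeparable W := by
  obtain ⟨K₁, K₂, W₁, W₂, hK, h₁, h₂, hW⟩ := hW
  obtain ⟨p₀, hp⟩ := Fintype.card_eq_one_iff.1 hP
  have : Unique P := ⟨⟨p₀⟩, hp⟩
  have hpre : ∀ (K : Matrix P P ℂ) (W : ProcOp P AI AO BI BO F),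
      precompose K W = ((Complex.normSq (K p₀ p₀) : ℝ) : ℂ) • W := by
    intro K W
    ext ⟨⟨p, a, b⟩, u⟩ ⟨⟨p', a', b'⟩, u'⟩
    obtain rfl := hp p
    obtain rfl := hp p'
    simp [ProcessMatrix.precompose_apply, hp, Complex.mul_conj]
  have hsum : Complex.normSq (K₁ p₀ p₀) + Complex.normSq (K₂ p₀ p₀) = 1 := by
    have h := congrFun (congrFun hK p₀) p₀
    have hu : (Finset.univ : Finset P) = {p₀} := 
      (Finset.eq_univ_iff_forall.2 fun p => Finset.mem_singleton.2 (hp p)).symm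
    simp only [Matrix.add_apply, Matrix.mul_apply, Matrix.conjTranspose_apply, hu,
      Finset.sum_singleton, Complex.star_def, ← Complex.normSq_eq_conj_mul_self,
      Matrix.one_apply_eq] at h
    exact_mod_cast h
  refine ⟨Complex.normSq (K₁ p₀ p₀), W₁, W₂, Complex.normSq_nonneg _, ?_, h₁, h₂, ?_⟩
  · have := Complex.normSq_nonneg (K₂ p₀ p₀)
    linarith
  · rw [hW, hpre, hpre, ← hsum, add_sub_cancel_left]

theorem IsPurifiable.isCausallySeparableGivenPast [Nonempty AI] [Nonempty AO] [Nonempty BI]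
    [Nonempty BO] {W : ProcOp P AI AO BI BO Unit} (hW : IsPurifiable W) :
    IsCausallySeparableGivenPast W := by
  obtain ⟨m, n, W', ψ, hpure, hψ, rfl⟩ := hW
  obtain ⟨α, β, h⟩ := hpure.exists_isFactorized
  rw [insertAndTrace_eq_precompose]
  refine h.discardFuture.exists_separation (traceFuture_posSemidef hpure.posSemidef) ?_
  ext p p'
  simp only [dotProduct, Pi.star_apply] at hψ
  rw [Matrix.mul_apply, Fintype.sum_prod_type, Matrix.one_apply, ← hψ]
  simp [apply_ite (starRingEnd ℂ), eq_comm]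

end Separation

end ProcessMatrix

theorem mainTheorem4 {P AI AO BI BO : Type}
    [Fintype P] [DecidableEq P] [Nonempty P]
    [Fintype AI] [DecidableEq AI] [Nonempty AI] [Fintype AO] [DecidableEq AO] [Nonempty AO]
    [Fintype BI] [DecidableEq BI] [Nonempty BI] [Fintype BO] [DecidableEq BO] [Nonempty BO]
    (W : ProcessMatrix.ProcOp P AI AO BI BO Unit) (hW : ProcessMatrix.IsPurifiable W) :
    (Fintype.card P = 1 → ProcessMatrix.IsCausallySeparable W) ∧
      ProcessMatrix.IsCausallySeparableGivenPast W :=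
  ⟨hW.isCausallySeparableGivenPast.isCausallySeparable, hW.isCausallySeparableGivenPast⟩
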